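/- Let $m\ge 0$, let $U\subseteq\mathbb R^2\times\mathbb R^{3m}$ be open, with coordinates $(x,y,u^\gamma,u^\gamma_x,u^\gamma_y)$, and let $f^\alpha\in C^\infty(U)$, $\alpha=1,\dots,m$. Consider the system $u^\alpha_{xy}=f^\alpha(x,y,u^\gamma,u^\gamma_x,u^\gamma_y)$. Its infinite prolonged equation manifold $\mathcal R^\infty$ has the coordinates $(x,y,u^\alpha,u^\alpha_x,u^\alpha_y,u^\alpha_{xx},u^\alpha_{yy},u^\alpha_{xxx},u^\alpha_{yyy},\dots)$; smooth functions on it are those which locally are smooth functions of finitely many of these coordinates. Put $$\theta^\alpha=du^\alpha-u^\alpha_x\,dx-u^\alpha_y\,dy,\quad \theta^\alpha_x=du^\alpha_x-u^\alpha_{xx}\,dx-f^\alpha\,dy,\quad \theta^\alpha_y=du^\alpha_y-f^\alpha\,dx-u^\alpha_{yy}\,dy .$$ For a first-order Lagrangian $L(x,y,u^\gamma,u^\gamma_x,u^\gamma_y)$ let $E_\alpha(L)=\frac{\partial L}{\partial u^\alpha}-D_x\frac{\partial L}{\partial u^\alpha_x}-D_y\frac{\partial L}{\partial u^\alpha_y}$,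 where $D_x,D_y$ are the (unconstrained) total derivatives. Repeated indices are summed. For an open set $W\subseteq U$ consider the following statements. (i) On the part of $\mathcal R^\infty$ over $W$ there are smooth functions $T_{\alpha\beta},S_{\alpha\beta},R_{\alpha\beta}$ with $\det(R_{\alpha\beta}+R_{\beta\alpha})\neq0$ everywhere, such that the type $(1,2)$ form $$\omega=(T_{\alpha\beta}\,dx+S_{\alpha\beta}\,dy)\wedge\theta^\alpha\wedge\theta^\beta+R_{\alpha\beta}\,(\theta^\alpha\wedge\theta^\beta_x\wedge dx-\theta^\beta\wedge\theta^\alpha_y\wedge dy)$$ satisfies $d\omega=0$. (ii) There are a smooth first-order multiplier $M_{\alpha\beta}(x,y,u^\gamma,u^\gamma_x,u^\gamma_y)$ on $W$ with $\det(M_{\alpha\beta})\ne0$ everywhere and a smooth first-order Lagrangian $L$ on $W$ such that $E_\alpha(L)=M_{\alpha\beta}(u^\beta_{xy}-f^\beta)$ at all second-order jets over $W$. (iii) There are smooth functions $M_{\alpha\beta},R_{\alpha\beta},Q_\alpha,P_\alpha,N$ of $(x,y,u^\gamma)$ on the projection of $W$ to $\mathbb R^2\times\mathbb R^m$, with $\det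 (M_{\alpha\beta})\neq0$ everywhere, such that $$L=-R_{\alpha\beta}u^\alpha_xu^\beta_y+Q_\alpha u^\alpha_x+P_\alpha u^\alpha_y+N$$ satisfies $E_\alpha(L)=M_{\alpha\beta}(u^\beta_{xy}-f^\beta)$ at all second-order jets over $W$. Then: (a) if $U$ is convex (for example the whole space or a ball), the statements (i), (ii), (iii) for $W=U$ are equivalent; (b) for arbitrary open $U$ the statements are locally equivalent: for every $z\in U$, the following are equivalent: (i) holds for some open $W$ with $z\in W\subseteq U$; (ii) holds for some such $W$; (iii) holds for some such $W$. -/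

import Mathlib

open scoped ContDiff Topology

namespace FGordon

/-- The jet space `J⁰(ℝ², ℝᵐ)`, with coordinates `(x, y, u)`. -/
abbrev J0 (m : ℕ) : Type := ℝ × ℝ × (Fin m → ℝ)

/-- The jet space `J¹(ℝ², ℝᵐ)`, with coordinates `(x, y, u, u_x, u_y)`. -/
abbrev J1 (m : ℕ) : Type := ℝ × ℝ × (Fin m → ℝ) × (Fin m → ℝ) × (Fin m → ℝ)

namespace J1

variable {m : ℕ}

def x (z : J1 m) : ℝ := z.1
def y (z : J1 m) : ℝ := z.2.1
def u (z : J1 m) : Fin m → ℝ := z.2.2.1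
def ux (z : J1 m) : Fin m → ℝ := z.2.2.2.1
def uy (z : J1 m) : Fin m → ℝ := z.2.2.2.2

/-- The projection `J¹ → J⁰`. -/
def toJ0 (z : J1 m) : J0 m := (z.x, z.y, z.u)

end J1

/-! ### Lagrangians and multipliers on the free jet spaces -/

/-- The second-order coordinates `(u_xx, u_xy, u_yy)`: a point of `J²(ℝ², ℝᵐ)` is a point of
`J1 m` together with a point of `Fibre2 m`. -/
structure Fibre2 (m : ℕ) where
  uxx : Fin m → ℝ
  uxy : Fin m → ℝ
  uyy : Fin m → ℝ

noncomputable section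

variable {m : ℕ}

/-- `∂g/∂u^α` for a function `g` on `J¹`. -/
def pU (α : Fin m) (g : J1 m → ℝ) (z : J1 m) : ℝ :=
  fderiv ℝ g z (0, 0, Pi.single α 1, 0, 0)

/-- `∂g/∂u^α_x` for a function `g` on `J¹`. -/
def pUx (α : Fin m) (g : J1 m → ℝ) (z : J1 m) : ℝ :=
  fderiv ℝ g z (0, 0, 0, Pi.single α 1, 0)

/-- `∂g/∂u^α_y` for a function `g` on `J¹`. -/
def pUy (α : Fin m) (g : J1 m → ℝ) (z : J1 m) : ℝ :=
  fderiv ℝ g z (0, 0, 0, 0, Pi.single α 1)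

/-- The total derivative of a function `g` on `J¹`, a function on `J²`:
`D_x g = ∂g/∂x + u_x^β ∂g/∂u^β + u_xx^β ∂g/∂u_x^β + u_xy^β ∂g/∂u_y^β`. -/
def Dx (g : J1 m → ℝ) (z : J1 m) (w : Fibre2 m) : ℝ :=
  fderiv ℝ g z (1, 0, z.ux, w.uxx, w.uxy)

/-- The total derivative of a function `g` on `J¹`, a function on `J²`:
`D_y g = ∂g/∂y + u_y^β ∂g/∂u^β + u_xy^β ∂g/∂u_x^β + u_yy^β ∂g/∂u_y^β`. -/
def Dy (g : J1 m → ℝ) (z : J1 m) (w : Fibre2 m) : ℝ :=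
  fderiv ℝ g z (0, 1, z.uy, w.uxy, w.uyy)

/-- The Euler-Lagrange expression of a first-order Lagrangian, a function on `J²`:
`E_α(L) = ∂L/∂u^α - D_x (∂L/∂u_x^α) - D_y (∂L/∂u_y^α)`. -/
def eulerLagrange (L : J1 m → ℝ) (α : Fin m) (z : J1 m) (w : Fibre2 m) : ℝ :=
  pU α L z - Dx (pUx α L) z w - Dy (pUy α L) z w

/-- `M` is a (non-degenerate, first-order) variational multiplier over `U ⊆ J¹` with
first-order Lagrangian `L` for the system `u_xy = f`: both are smooth on `U`, `det M ≠ 0` on `U`,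
and `E_α(L) = M_{αβ} (u^β_xy - f^β)` at every point of `J²` over `U`. -/
structure IsMultiplier (f : J1 m → Fin m → ℝ) (U : Set (J1 m))
    (M : J1 m → Matrix (Fin m) (Fin m) ℝ) (L : J1 m → ℝ) : Prop where
  smooth_M : ∀ α β, ContDiffOn ℝ ∞ (fun z => M z α β) U
  smooth_L : ContDiffOn ℝ ∞ L U
  det_ne_zero : ∀ z ∈ U, (M z).det ≠ 0
  eulerLagrange_eq : ∀ z ∈ U, ∀ (w : Fibre2 m) (α : Fin m),
    eulerLagrange L α z w = ∑ β, M z α β * (w.uxy β - f z β)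

/-- The Lagrangian `-R_{αβ} u^α_x u^β_y + Q_α u^α_x + P_α u^α_y + N` with coefficients that are
functions of `(x, y, u)`. -/
def quadLagrangian (R : J0 m → Matrix (Fin m) (Fin m) ℝ) (Q P : J0 m → Fin m → ℝ)
    (N : J0 m → ℝ) (z : J1 m) : ℝ :=
  -(∑ α, ∑ β, R z.toJ0 α β * z.ux α * z.uy β) + ∑ α, Q z.toJ0 α * z.ux α
    + ∑ α, P z.toJ0 α * z.uy α + N z.toJ0

/-! ### The infinite prolonged equation manifold -/

/-- The manifold `R^∞` of a system `u_xy = f(x, y, u, u_x, u_y)`, in its global coordinates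
`(x, y, u, (u_x, u_xx, u_xxx, …), (u_y, u_yy, u_yyy, …))`. It carries the product topology. -/
abbrev RInf (m : ℕ) : Type := ℝ × ℝ × (Fin m → ℝ) × (ℕ → Fin m → ℝ) × (ℕ → Fin m → ℝ)

/-- The manifold `R^k`: as `RInf`, but with pure derivatives up to order `k` only. -/
abbrev RFin (m k : ℕ) : Type :=
  ℝ × ℝ × (Fin m → ℝ) × (Fin k → Fin m → ℝ) × (Fin k → Fin m → ℝ)

namespace RInf

def x (p : RInf m) : ℝ := p.1
def y (p : RInf m) : ℝ := p.2.1
def u (p : RInf m) : Fin m → ℝ := p.2.2.1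

/-- `p.xs n` is the value of `∂_x^{n+1} u`. -/
def xs (p : RInf m) : ℕ → Fin m → ℝ := p.2.2.2.1

/-- `p.ys n` is the value of `∂_y^{n+1} u`. -/
def ys (p : RInf m) : ℕ → Fin m → ℝ := p.2.2.2.2

/-- The projection `R^∞ → R^k`. -/
def proj (k : ℕ) (p : RInf m) : RFin m k :=
  (p.x, p.y, p.u, fun n => p.xs n, fun n => p.ys n)

/-- The projection `R^∞ → J¹`. -/
def toJ1 (p : RInf m) : J1 m := (p.x, p.y, p.u, p.xs 0, p.ys 0)

end RInf

/-- Smooth functions on (an open subset `O` of) `R^∞`: locally, they are smooth functions of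
finitely many of the coordinates. -/
def SmoothOn (g : RInf m → ℝ) (O : Set (RInf m)) : Prop :=
  ∀ p ∈ O, ∃ (k : ℕ) (G : RFin m k → ℝ),
    ContDiffAt ℝ ∞ G (p.proj k) ∧ g =ᶠ[𝓝 p] fun q => G (q.proj k)

/-! ### Differential forms on `R^∞` -/

/-- Differential forms of degree `n` on `R^∞`; the tangent space at each point is identified with
`RInf m` by means of the coordinates. -/
abbrev DForm (m n : ℕ) : Type := RInf m → (RInf m [⋀^Fin n]→ₗ[ℝ] ℝ)

/-- The exterior derivative, on constant vector fields `v 0, …, v n`: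
`dη (v 0, …, v n) = ∑ i, (-1)^i ∂_{v i} (η (v 0, …, v (i-1), v (i+1), …, v n))`. -/
def extD {n : ℕ} (η : DForm m n) (p : RInf m) (v : Fin (n + 1) → RInf m) : ℝ :=
  ∑ i : Fin (n + 1), (-1) ^ (i : ℕ) * lineDeriv ℝ (fun q => η q (i.removeNth v)) p (v i)

/-- The wedge product `a ∧ b ∧ c` of three covectors,
`(a ∧ b ∧ c) (v 0, v 1, v 2) = det (a (v i), b (v i), c (v i))`. -/
def wedge3 (a b c : Module.Dual ℝ (RInf m)) : RInf m [⋀^Fin 3]→ₗ[ℝ] ℝ :=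
  (Matrix.detRowAlternating (R := ℝ) (n := Fin 3)).compLinearMap (LinearMap.pi ![a, b, c])

/-- The covector `dx`. -/
def dx : Module.Dual ℝ (RInf m) where
  toFun v := v.x
  map_add' _ _ := rfl
  map_smul' _ _ := rfl

/-- The covector `dy`. -/
def dy : Module.Dual ℝ (RInf m) where
  toFun v := v.y
  map_add' _ _ := rfl
  map_smul' _ _ := rfl

/-- The covector `du^α`. -/
def du (α : Fin m) : Module.Dual ℝ (RInf m) where
  toFun v := v.u α
  map_add' _ _ := rfl
  map_smul' _ _ := rfl

/-- The covector `du^α_x`. -/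
def dux (α : Fin m) : Module.Dual ℝ (RInf m) where
  toFun v := v.xs 0 α
  map_add' _ _ := rfl
  map_smul' _ _ := rfl

/-- The covector `du^α_y`. -/
def duy (α : Fin m) : Module.Dual ℝ (RInf m) where
  toFun v := v.ys 0 α
  map_add' _ _ := rfl
  map_smul' _ _ := rfl

/-- The contact form `θ^α = du^α - u^α_x dx - u^α_y dy`. -/
def theta (α : Fin m) (p : RInf m) : Module.Dual ℝ (RInf m) :=
  du α - p.xs 0 α • dx - p.ys 0 α • dy

/-- The contact form `θ^α_x = du^α_x - u^α_xx dx - f^α dy`. -/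
def thetaX (f : J1 m → Fin m → ℝ) (α : Fin m) (p : RInf m) : Module.Dual ℝ (RInf m) :=
  dux α - p.xs 1 α • dx - f p.toJ1 α • dy

/-- The contact form `θ^α_y = du^α_y - f^α dx - u^α_yy dy`. -/
def thetaY (f : J1 m → Fin m → ℝ) (α : Fin m) (p : RInf m) : Module.Dual ℝ (RInf m) :=
  duy α - f p.toJ1 α • dx - p.ys 1 α • dy

/-- The type `(1,2)` form
`ω = (T_{αβ} dx + S_{αβ} dy) ∧ θ^α ∧ θ^β + R_{αβ} (θ^α ∧ θ^β_x ∧ dx - θ^β ∧ θ^α_y ∧ dy)`. -/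
def omega (f : J1 m → Fin m → ℝ) (T S R : RInf m → Matrix (Fin m) (Fin m) ℝ) : DForm m 3 :=
  fun p => ∑ α, ∑ β,
    (wedge3 (T p α β • dx + S p α β • dy) (theta α p) (theta β p)
      + R p α β • (wedge3 (theta α p) (thetaX f β p) dx - wedge3 (theta β p) (thetaY f α p) dy))

/-! ### The three properties of the system `u_xy = f` over a set `U ⊆ J¹` -/

/-- There is a closed form `ω` of the above shape on the part of `R^∞` over `U`, with smooth
coefficients, that is non-degenerate: `det (R_{αβ} + R_{βα}) ≠ 0`. -/
def HasClosedForm (f : J1 m → Fin m → ℝ) (U : Set (J1 m)) : Prop :=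
  ∃ T S R : RInf m → Matrix (Fin m) (Fin m) ℝ,
    (∀ α β, SmoothOn (fun p => T p α β) (RInf.toJ1 ⁻¹' U)) ∧
    (∀ α β, SmoothOn (fun p => S p α β) (RInf.toJ1 ⁻¹' U)) ∧
    (∀ α β, SmoothOn (fun p => R p α β) (RInf.toJ1 ⁻¹' U)) ∧
    (∀ p ∈ RInf.toJ1 ⁻¹' U, (R p + (R p).transpose).det ≠ 0) ∧
    ∀ p ∈ RInf.toJ1 ⁻¹' U, ∀ v, extD (omega f T S R) p v = 0

/-- There are a first-order multiplier and a first-order Lagrangian over `U`. -/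
def HasFirstOrderMultiplier (f : J1 m → Fin m → ℝ) (U : Set (J1 m)) : Prop :=
  ∃ (M : J1 m → Matrix (Fin m) (Fin m) ℝ) (L : J1 m → ℝ), IsMultiplier f U M L

/-- There are a multiplier `M(x, y, u)` and a Lagrangian
`-R_{αβ} u^α_x u^β_y + Q_α u^α_x + P_α u^α_y + N` over `U`, where `R, Q, P, N` are smooth functions
of `(x, y, u)` on the projection of `U` to `J⁰`. -/
def HasZerothOrderMultiplier (f : J1 m → Fin m → ℝ) (U : Set (J1 m)) : Prop :=
  ∃ (M R : J0 m → Matrix (Fin m) (Fin m) ℝ) (Q P : J0 m → Fin m → ℝ) (N : J0 m → ℝ),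
    (∀ α β, ContDiffOn ℝ ∞ (fun z => M z α β) (J1.toJ0 '' U)) ∧
    (∀ α β, ContDiffOn ℝ ∞ (fun z => R z α β) (J1.toJ0 '' U)) ∧
    (∀ α, ContDiffOn ℝ ∞ (fun z => Q z α) (J1.toJ0 '' U)) ∧
    (∀ α, ContDiffOn ℝ ∞ (fun z => P z α) (J1.toJ0 '' U)) ∧
    ContDiffOn ℝ ∞ N (J1.toJ0 '' U) ∧
    IsMultiplier f U (fun z => M z.toJ0) (quadLagrangian R Q P N)

end

end FGordon

/-! The bridge between Lagrangians and closed forms is the Poincaré-Cartan form Θ_L = L dx∧dy +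
L_{u_x} θ∧dy - L_{u_y} θ∧dx. If L is affine in u_x and affine in u_y, then dΘ_L = E_α(L) θ^α∧dx∧dy
plus a form of the shape of ω, whose coefficients are second derivatives of L (`dCartan_eq`).

From a Lagrangian to a closed form: since E_α(L) contains neither u_xx nor u_yy, L is affine in u_x
and in u_y, and the coefficient of u_xy gives R + Rᵀ = -M. On the equation E_α(L) vanishes, so dΘ_L
pulls back to ω, which is therefore closed and non-degenerate
(`HasFirstOrderMultiplier.hasClosedForm`).

From a closed form to a quadratic Lagrangian (`HasClosedForm.hasZerothOrderMultiplier`): restricting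
ω to the points whose pure derivatives of order at least two vanish gives a closed 3-form on J¹.
Closedness forces its R to depend on (x, y, u) only (`fderiv_R_vertical_eq_zero`). With L₀ = R_{αβ}
u_x^β u_y^α, the difference ω - dΘ_{L₀} is closed and free of θ_x and θ_y, so it descends to J⁰ and
has a primitive β there (`exists_primitive_on_J0`). By `el_bilLag`, adding β(D_x, D_y) to L₀ changes
the Euler-Lagrange expression by dβ(∂_u, D_x, D_y), which contains no second derivatives and cancels
exactly the value of E(L₀) at u_xy = f. What remains is -(R + Rᵀ)(u_xy - f).

A quadratic Lagrangian is in particular a first-order one. Convexity serves twice: for constancy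
along the fibres of J¹ → J⁰ and for the Poincaré lemma on J⁰. The local statement follows by
shrinking to a ball. -/

open scoped ContDiff Topology
universe u
set_option linter.unusedSectionVars false
set_option maxSynthPendingDepth 3

/-! ### Smooth dependence of integrals over [0, 1] on parameters. -/

section ParametricIntegral

variable {E G : Type u} [NormedAddCommGroup E] [NormedSpace ℝ E]
  [NormedAddCommGroup G] [NormedSpace ℝ G]

theorem continuousOn_parametric_intervalIntegral {E : Type u} [NormedAddCommGroup E]
    {F : E × ℝ → G} {U : Set E}
    (hF : ContinuousOn F (U ×ˢ Set.Icc (0 : ℝ) 1)) :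
    ContinuousOn (fun x => ∫ t in (0 : ℝ)..1, F (x, t)) U := by
  rw [continuousOn_iff_continuous_domRestrict]
  -- Clamping t to [0, 1] makes the integrand continuous on all of U × ℝ, although nothing is known
  -- about F for other t; the integral does not change.
  let H : U → ℝ → G := fun x t => F (x, (Set.projIcc (0 : ℝ) 1 zero_le_one t : ℝ))
  have hH : Continuous (Function.uncurry H) := by
    have : Function.uncurry H = F ∘ fun q : U × ℝ =>
        ((q.1 : E), (Set.projIcc (0 : ℝ) 1 zero_le_one q.2 : ℝ)) := rfl
    rw [this]
    refine hF.comp_continuous ?_ ?_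
    · exact (continuous_subtype_val.comp continuous_fst).prodMk
        (continuous_subtype_val.comp (continuous_projIcc.comp continuous_snd))
    · exact fun q => ⟨q.1.2, Subtype.coe_prop _⟩
  have h := intervalIntegral.continuous_parametric_intervalIntegral_of_continuous'
    (μ := MeasureTheory.volume) hH 0 1
  convert h using 2 with x
  refine intervalIntegral.integral_congr fun t ht => ?_
  rw [Set.uIcc_of_le zero_le_one] at ht
  simp [H, Set.projIcc_of_mem zero_le_one ht]

variable [FiniteDimensional ℝ E]

/-- Differentiation under the integral sign. The dominating constant is the maximum of the partial
derivative on a closed ball times [0, 1], compact because E is finite-dimensional. -/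
theorem hasFDerivAt_parametric_intervalIntegral {F : E × ℝ → G} {V : Set (E × ℝ)} {U : Set E}
    (hV : IsOpen V) (hU : IsOpen U) (hUV : U ×ˢ Set.Icc (0 : ℝ) 1 ⊆ V)
    (hF : ContDiffOn ℝ 1 F V) {x : E} (hx : x ∈ U) :
    HasFDerivAt (fun x => ∫ t in (0 : ℝ)..1, F (x, t))
      (∫ t in (0 : ℝ)..1, (fderiv ℝ F (x, t)).comp (ContinuousLinearMap.inl ℝ E ℝ)) x := by
  have hF' : ContinuousOn (fderiv ℝ F) V := hF.continuousOn_fderiv_of_isOpen hV le_rfl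
  have hF'' : ContinuousOn (fun q => (fderiv ℝ F q).comp (ContinuousLinearMap.inl ℝ E ℝ)) V :=
    hF'.clm_comp continuousOn_const
  obtain ⟨ε, hε, hball⟩ := Metric.nhds_basis_closedBall.mem_iff.1 (hU.mem_nhds hx)
  have hK : IsCompact (Metric.closedBall x ε ×ˢ Set.Icc (0 : ℝ) 1) :=
    (isCompact_closedBall x ε).prod isCompact_Icc
  obtain ⟨C, hC⟩ := hK.exists_bound_of_continuousOn
    (hF''.mono ((Set.prod_mono hball le_rfl).trans hUV))
  have hslice : ∀ y ∈ U, ContinuousOn (fun t : ℝ => ((y, t) : E × ℝ)) (Set.uIcc (0 : ℝ) 1) :=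
    fun y _ => by fun_prop
  have hmaps : ∀ y ∈ U, Set.MapsTo (fun t : ℝ => ((y, t) : E × ℝ)) (Set.uIcc (0 : ℝ) 1) V := by
    intro y hy t ht
    rw [Set.uIcc_of_le zero_le_one] at ht
    exact hUV ⟨hy, ht⟩
  have hmeas : ∀ y ∈ U, IntervalIntegrable (fun t => F (y, t)) MeasureTheory.volume 0 1 :=
    fun y hy => (hF.continuousOn.comp (hslice y hy) (hmaps y hy)).intervalIntegrable
  refine intervalIntegral.hasFDerivAt_integral_of_dominated_of_fderiv_le
    (F' := fun y t => (fderiv ℝ F (y, t)).comp (ContinuousLinearMap.inl ℝ E ℝ))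
    (bound := fun _ => C) (Metric.closedBall_mem_nhds x hε) ?_ (hmeas x hx) ?_ ?_ ?_ ?_
  · filter_upwards [hU.mem_nhds hx] with y hy
    exact (intervalIntegrable_iff.1 (hmeas y hy)).aestronglyMeasurable
  · exact (intervalIntegrable_iff.1 ((hF''.comp (hslice x hx) (hmaps x hx)).intervalIntegrable
      (μ := MeasureTheory.volume))).aestronglyMeasurable
  · refine Filter.Eventually.of_forall fun t ht y hy => hC (y, t) ⟨hy, ?_⟩
    rw [Set.uIoc_of_le zero_le_one] at ht
    exact Set.Ioc_subset_Icc_self ht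
  · exact intervalIntegrable_const
  · refine Filter.Eventually.of_forall fun t ht y hy => ?_
    rw [Set.uIoc_of_le zero_le_one] at ht
    have hmem : (y, t) ∈ V := hUV ⟨hball hy, Set.Ioc_subset_Icc_self ht⟩
    have h1 : HasFDerivAt F (fderiv ℝ F (y, t)) (y, t) :=
      ((hF.contDiffAt (hV.mem_nhds hmem)).differentiableAt one_ne_zero).hasFDerivAt
    have h2 : HasFDerivAt (fun y : E => ((y, t) : E × ℝ)) (ContinuousLinearMap.inl ℝ E ℝ) y :=
      hasFDerivAt_prodMk_left y t
    exact h1.comp y h2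

/-- Induction on n: the derivative is again a parametric integral, with values in `E →L[ℝ] G`. Hence
the target space is quantified inside the induction, and E and G share a universe. -/
theorem contDiffOn_nat_parametric_intervalIntegral (n : ℕ) :
    ∀ {G : Type u} [NormedAddCommGroup G] [NormedSpace ℝ G] {F : E × ℝ → G}
    {V : Set (E × ℝ)} {U : Set E}, IsOpen V → IsOpen U → U ×ˢ Set.Icc (0 : ℝ) 1 ⊆ V →
    ContDiffOn ℝ n F V → ContDiffOn ℝ n (fun x => ∫ t in (0 : ℝ)..1, F (x, t)) U := by
  induction n with
  | zero =>
    intro G _ _ F V U _ _ hUV hF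
    exact contDiffOn_zero.2 (continuousOn_parametric_intervalIntegral (hF.continuousOn.mono hUV))
  | succ n ih =>
    intro G _ _ F V U hV hU hUV hF
    have h1 : ContDiffOn ℝ 1 F V := hF.of_le (by norm_cast; omega)
    have hd := fun x hx => hasFDerivAt_parametric_intervalIntegral hV hU hUV h1 (x := x) hx
    push_cast at hF ⊢
    rw [contDiffOn_succ_iff_fderiv_of_isOpen hU]
    refine ⟨fun x hx => (hd x hx).differentiableAt.differentiableWithinAt, by simp, ?_⟩
    refine ContDiffOn.congr ?_ fun x hx => (hd x hx).fderiv
    refine ih (F := fun q => (fderiv ℝ F q).comp (ContinuousLinearMap.inl ℝ E ℝ)) hV hU hUV ?_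
    exact ((contDiffOn_succ_iff_fderiv_of_isOpen hV).1 hF).2.2.clm_comp contDiffOn_const

theorem contDiffOn_parametric_intervalIntegral {F : E × ℝ → G} {V : Set (E × ℝ)} {U : Set E}
    (hV : IsOpen V) (hU : IsOpen U) (hUV : U ×ˢ Set.Icc (0 : ℝ) 1 ⊆ V) (hF : ContDiffOn ℝ ∞ F V) :
    ContDiffOn ℝ ∞ (fun x => ∫ t in (0 : ℝ)..1, F (x, t)) U :=
  contDiffOn_infty.2 fun n =>
    contDiffOn_nat_parametric_intervalIntegral n hV hU hUV (contDiffOn_infty.1 hF n)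

end ParametricIntegral

/-! ### The Poincaré lemma and d² = 0. -/

section Poincare

variable {E : Type u} [NormedAddCommGroup E] [NormedSpace ℝ E] [FiniteDimensional ℝ E]

/-- The Poincaré lemma for `3`-forms on a convex open set. -/
theorem exists_primitive_of_closed_threeForm {U : Set E} (hU : IsOpen U) (hconv : Convex ℝ U)
    {s : E → E →L[ℝ] E →L[ℝ] E →L[ℝ] ℝ} (hs : ContDiffOn ℝ ∞ s U)
    (h12 : ∀ z ∈ U, ∀ a b c, s z a b c = -s z b a c)
    (h23 : ∀ z ∈ U, ∀ a b c, s z a b c = -s z a c b)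
    (hcl : ∀ z ∈ U, ∀ a b c d, fderiv ℝ s z a b c d - fderiv ℝ s z b a c d
      + fderiv ℝ s z c a b d - fderiv ℝ s z d a b c = 0) :
    ∃ β : E → E →L[ℝ] E →L[ℝ] ℝ, ContDiffOn ℝ ∞ β U ∧
      (∀ z ∈ U, ∀ a b, β z a b = -β z b a) ∧
      ∀ z ∈ U, ∀ a b c, fderiv ℝ β z a b c - fderiv ℝ β z b a c + fderiv ℝ β z c a b
        = s z a b c := by
  rcases U.eq_empty_or_nonempty with rfl | ⟨z₀, hz₀⟩
  · exact ⟨0, contDiffOn_empty, by simp, by simp⟩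
  let w : E × ℝ → E := fun q => z₀ + q.2 • (q.1 - z₀)
  have hw : ContDiff ℝ ∞ w := by fun_prop
  -- The radial homotopy operator. The factor t² comes from pulling back the two free arguments
  -- along z ↦ z₀ + t(z - z₀).
  let F : E × ℝ → E →L[ℝ] E →L[ℝ] ℝ := fun q => q.2 ^ 2 • s (w q) (q.1 - z₀)
  let V : Set (E × ℝ) := w ⁻¹' U
  have hV : IsOpen V := hU.preimage hw.continuous
  have hUV : U ×ˢ Set.Icc (0 : ℝ) 1 ⊆ V := by
    rintro ⟨z, t⟩ ⟨hz, ht⟩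
    exact hconv.add_smul_sub_mem hz₀ hz ht
  have hF : ContDiffOn ℝ ∞ F V := by
    have h1 : ContDiffOn ℝ ∞ (fun q => s (w q)) V := hs.comp hw.contDiffOn fun _ h => h
    exact (contDiff_snd.pow 2).contDiffOn.smul
      (h1.clm_apply (contDiff_fst.sub contDiff_const).contDiffOn)
  have hsd : ∀ z ∈ U, HasFDerivAt s (fderiv ℝ s z) z := fun z hz =>
    ((hs.contDiffAt (hU.mem_nhds hz)).differentiableAt (by simp)).hasFDerivAt
  refine ⟨fun z => ∫ t in (0 : ℝ)..1, F (z, t),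
    contDiffOn_parametric_intervalIntegral hV hU hUV hF, ?_, ?_⟩
  all_goals
    intro z hz
    have hmaps : Set.MapsTo (fun t : ℝ => ((z, t) : E × ℝ)) (Set.uIcc (0 : ℝ) 1) V := by
      intro t ht
      rw [Set.uIcc_of_le zero_le_one] at ht
      exact hUV ⟨hz, ht⟩
    have hint : IntervalIntegrable (fun t => F (z, t)) MeasureTheory.volume 0 1 :=
      (hF.continuousOn.comp (by fun_prop) hmaps).intervalIntegrable
  · intro a b
    let Φ : (E →L[ℝ] E →L[ℝ] ℝ) →L[ℝ] ℝ := LinearMap.toContinuousLinearMap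
      { toFun := fun A => A a b + A b a
        map_add' := fun A B => by simp only [add_apply]; ring
        map_smul' := fun r A => by simp only [smul_apply, smul_eq_mul, RingHom.id_apply]; ring }
    have h : Φ (∫ t in (0 : ℝ)..1, F (z, t)) = 0 := by
      rw [← Φ.intervalIntegral_comp_comm hint, intervalIntegral.integral_zero_ae]
      refine Filter.Eventually.of_forall fun t ht => ?_
      rw [Set.uIoc_of_le zero_le_one] at ht
      have hmem : w (z, t) ∈ U := hUV (a := (z, t)) ⟨hz, Set.Ioc_subset_Icc_self ht⟩
      have := h23 _ hmem (z - z₀) a b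
      change t ^ 2 * s (w (z, t)) (z - z₀) a b + t ^ 2 * s (w (z, t)) (z - z₀) b a = 0
      rw [this]; ring
    exact eq_neg_of_add_eq_zero_left h
  · intro a b c
    have hd := hasFDerivAt_parametric_intervalIntegral hV hU hUV (hF.of_le (by simp)) hz
    let Φ : (E →L[ℝ] E →L[ℝ] E →L[ℝ] ℝ) →L[ℝ] ℝ := LinearMap.toContinuousLinearMap
      { toFun := fun A => A a b c - A b a c + A c a b
        map_add' := fun A B => by simp only [add_apply]; ring
        map_smul' := fun r A => by simp only [smul_apply, smul_eq_mul, RingHom.id_apply]; ring }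
    let ev : (E →L[ℝ] E →L[ℝ] E →L[ℝ] ℝ) →L[ℝ] ℝ := LinearMap.toContinuousLinearMap
      { toFun := fun A => A a b c
        map_add' := fun A B => rfl
        map_smul' := fun r A => rfl }
    have hint' : IntervalIntegrable
        (fun t => (fderiv ℝ F (z, t)).comp (ContinuousLinearMap.inl ℝ E ℝ))
        MeasureTheory.volume 0 1 :=
      ((((hF.continuousOn_fderiv_of_isOpen hV (by simp)).clm_comp continuousOn_const).comp
        (by fun_prop) hmaps)).intervalIntegrable
    rw [hd.fderiv]
    change Φ _ = _
    rw [← Φ.intervalIntegral_comp_comm hint']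
    -- Closedness turns the alternated derivative of the integrand into d/dt of t³ s(z₀ + t(z -
    -- z₀)); integrating from 0 to 1 leaves s(z).
    have hderiv : ∀ t ∈ Set.uIcc (0 : ℝ) 1,
        HasDerivAt (fun t => t ^ 3 * s (w (z, t)) a b c)
          (Φ ((fderiv ℝ F (z, t)).comp (ContinuousLinearMap.inl ℝ E ℝ))) t := by
      intro t ht
      have hmem : w (z, t) ∈ U := hmaps ht
      have hsw := hsd _ hmem
      have h1 : HasFDerivAt (fun y => F (y, t))
          ((fderiv ℝ F (z, t)).comp (ContinuousLinearMap.inl ℝ E ℝ)) z :=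
        HasFDerivAt.comp (f := fun y : E => ((y, t) : E × ℝ)) z
          ((hF.contDiffAt (hV.mem_nhds hmem)).differentiableAt (by simp)).hasFDerivAt
          (hasFDerivAt_prodMk_left z t)
      have hwz : HasFDerivAt (fun y => w (y, t)) (t • ContinuousLinearMap.id ℝ E) z :=
        (((hasFDerivAt_id z).sub_const z₀).const_smul t).const_add z₀
      have h2 := (((hsw.comp z hwz).clm_apply ((hasFDerivAt_id z).sub_const z₀)).const_smul (t ^ 2))
      have h3 := h1.unique h2
      have hwt : HasDerivAt (fun r => w (z, r)) (z - z₀) t := by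
        have h := ((hasDerivAt_id t).smul_const (z - z₀)).const_add z₀
        rw [one_smul] at h
        exact h
      have h4 : HasDerivAt (fun t => s (w (z, t)) a b c)
          (fderiv ℝ s (w (z, t)) (z - z₀) a b c) t :=
        ev.hasFDerivAt.comp_hasDerivAt t (hsw.comp_hasDerivAt t hwt)
      have h5 := (hasDerivAt_pow 3 t).mul h4
      refine h5.congr_deriv ?_
      rw [h3]
      simp [Φ]
      have e0 := hcl _ hmem (z - z₀) a b c
      have e1 := h12 _ hmem b a c
      have e2 := h12 _ hmem c a b
      have e3 := h23 _ hmem a c b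
      simp only [map_sub, sub_apply] at e0
      rw [e1, e2, e3]
      linear_combination t ^ 3 * e0
    rw [intervalIntegral.integral_eq_sub_of_hasDerivAt hderiv
      ((Φ.continuous.comp_continuousOn (((hF.continuousOn_fderiv_of_isOpen hV
        (by simp)).clm_comp continuousOn_const).comp (by fun_prop) hmaps)).intervalIntegrable)]
    simp [w]

end Poincare

/-- The second exterior derivative of a `2`-form vanishes. -/
theorem threeForm_extDeriv_eq_zero {E : Type*} [NormedAddCommGroup E] [NormedSpace ℝ E]
    {B : E → E → E → ℝ} {z : E} (hB : ∀ b c, ContDiffAt ℝ 2 (fun y => B y b c) z)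
    (dB : E → E → E → E → ℝ)
    (hdB : ∀ a b c, (fun y => dB y a b c) =ᶠ[𝓝 z] fun y => fderiv ℝ (fun y => B y b c) y a
      - fderiv ℝ (fun y => B y a c) y b + fderiv ℝ (fun y => B y a b) y c) (a b c d : E) :
    fderiv ℝ (fun y => dB y b c d) z a - fderiv ℝ (fun y => dB y a c d) z b
      + fderiv ℝ (fun y => dB y a b d) z c - fderiv ℝ (fun y => dB y a b c) z d = 0 := by
  have hd : ∀ b c a, DifferentiableAt ℝ (fun y => fderiv ℝ (fun y => B y b c) y a) z := by
    intro b c a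
    exact (((hB b c).fderiv_right (m := 1) (by norm_num)).differentiableAt
      (by simp)).clm_apply (differentiableAt_const a)
  have hval : ∀ a b c e, fderiv ℝ (fun y => dB y a b c) z e =
      fderiv ℝ (fderiv ℝ (fun y => B y b c)) z e a - fderiv ℝ (fderiv ℝ (fun y => B y a c)) z e b
        + fderiv ℝ (fderiv ℝ (fun y => B y a b)) z e c := by
    intro a b c e
    have key : ∀ b c a, fderiv ℝ (fun y => fderiv ℝ (fun y => B y b c) y a) z e =
        fderiv ℝ (fderiv ℝ (fun y => B y b c)) z e a := by
      intro b c a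
      rw [fderiv_clm_apply (((hB b c).fderiv_right (m := 1) (by norm_num)).differentiableAt
        (by simp)) (differentiableAt_const a)]
      simp
    rw [(hdB a b c).fderiv_eq, fderiv_fun_add ((hd _ _ _).fun_sub (hd _ _ _)) (hd _ _ _),
      fderiv_fun_sub (hd _ _ _) (hd _ _ _)]
    simp [key]
  -- After expansion the twelve second derivatives cancel in pairs by this symmetry.
  have hsymm : ∀ b c v w, fderiv ℝ (fderiv ℝ (fun y => B y b c)) z v w =
      fderiv ℝ (fderiv ℝ (fun y => B y b c)) z w v := fun b c v w =>
    ((hB b c).isSymmSndFDerivAt (by simp)).eq v w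
  simp only [hval]
  rw [hsymm c d a b, hsymm b d a c, hsymm b c a d, hsymm a d b c, hsymm a c b d, hsymm a b c d]
  ring

namespace FGordon

noncomputable section

/-! ### Matrix bilinear forms and the expression of ω in the coframe (dx, dy, θ, θ_x, θ_y). -/

variable {m : ℕ}

/-- The bilinear form of a square matrix. -/
def bil (A : Matrix (Fin m) (Fin m) ℝ) (a b : Fin m → ℝ) : ℝ := ∑ α, ∑ β, A α β * a α * b β

theorem bil_eq_of_linear (A : Matrix (Fin m) (Fin m) ℝ)
    (φ : (Fin m → ℝ) →ₗ[ℝ] (Fin m → ℝ) →ₗ[ℝ] ℝ)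
    (h : ∀ α β, A α β = φ (Pi.single α 1) (Pi.single β 1)) (a b : Fin m → ℝ) :
    bil A a b = φ a b := by
  conv_rhs => rw [pi_eq_sum_univ' a, pi_eq_sum_univ' b]
  simp only [map_sum, map_smul, LinearMap.sum_apply, LinearMap.smul_apply, smul_eq_mul, bil,
    Finset.mul_sum]
  rw [Finset.sum_comm]
  refine Finset.sum_congr rfl fun β _ => Finset.sum_congr rfl fun α _ => ?_
  rw [h]
  ring

theorem bil_single (A : Matrix (Fin m) (Fin m) ℝ) (α β : Fin m) :
    bil A (Pi.single α 1) (Pi.single β 1) = A α β := by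
  simp [bil, Pi.single_apply]

theorem bil_sub_matrix (A B : Matrix (Fin m) (Fin m) ℝ) (a b : Fin m → ℝ) :
    bil (A - B) a b = bil A a b - bil B a b := by
  simp [bil, sub_mul, Finset.sum_sub_distrib]

theorem bil_zero_left (A : Matrix (Fin m) (Fin m) ℝ) (b : Fin m → ℝ) : bil A 0 b = 0 := by
  simp [bil]

theorem bil_zero_right (A : Matrix (Fin m) (Fin m) ℝ) (a : Fin m → ℝ) : bil A a 0 = 0 := by
  simp [bil]

/-- The value of `(T_{αβ} dx + S_{αβ} dy) ∧ θ^α ∧ θ^β + R_{αβ} (θ^α ∧ θ^β_x ∧ dx - θ^β ∧ θ^α_y ∧ dy)`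
on three vectors with components `(dx, dy, θ, θ_x, θ_y)`. -/
def tri (T S R : Matrix (Fin m) (Fin m) ℝ) (a b c : J1 m) : ℝ :=
  a.x * (bil T b.u c.u - bil T c.u b.u) + b.x * (bil T c.u a.u - bil T a.u c.u)
    + c.x * (bil T a.u b.u - bil T b.u a.u)
    + (a.y * (bil S b.u c.u - bil S c.u b.u) + b.y * (bil S c.u a.u - bil S a.u c.u)
    + c.y * (bil S a.u b.u - bil S b.u a.u))
    + (a.x * (bil R b.u c.ux - bil R c.u b.ux) + b.x * (bil R c.u a.ux - bil R a.u c.ux)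
    + c.x * (bil R a.u b.ux - bil R b.u a.ux))
    - (a.y * (bil R c.uy b.u - bil R b.uy c.u) + b.y * (bil R a.uy c.u - bil R c.uy a.u)
    + c.y * (bil R b.uy a.u - bil R a.uy b.u))

/-- The components of `v` in the coframe `(dx, dy, θ, θ_x, θ_y)` at the jet `(z, w)`. -/
def coframe (z : J1 m) (w : Fibre2 m) (v : J1 m) : J1 m :=
  (v.x, v.y, v.u - v.x • z.ux - v.y • z.uy, v.ux - v.x • w.uxx - v.y • w.uxy,
    v.uy - v.x • w.uxy - v.y • w.uyy)

/-- The second-order jet over `R^∞`. -/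
def jet2 (f : J1 m → Fin m → ℝ) (p : RInf m) : Fibre2 m := ⟨p.xs 1, f p.toJ1, p.ys 1⟩

theorem wedge3_apply (a b c : Module.Dual ℝ (RInf m)) (v : Fin 3 → RInf m) :
    wedge3 a b c v = a (v 0) * b (v 1) * c (v 2) - a (v 0) * c (v 1) * b (v 2)
      - b (v 0) * a (v 1) * c (v 2) + b (v 0) * c (v 1) * a (v 2)
      + c (v 0) * a (v 1) * b (v 2) - c (v 0) * b (v 1) * a (v 2) := by
  refine (Matrix.det_fin_three (Matrix.of fun i j => LinearMap.pi ![a, b, c] (v i) j)).trans ?_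
  simp

theorem theta_apply (z : RInf m) (w : Fibre2 m) (v : RInf m) (α : Fin m) :
    theta α z v = (coframe z.toJ1 w v.toJ1).u α := by
  change v.u α - z.xs 0 α * v.x - z.ys 0 α * v.y = v.u α - v.x * z.xs 0 α - v.y * z.ys 0 α
  ring

theorem thetaX_apply (f : J1 m → Fin m → ℝ) (z v : RInf m) (α : Fin m) :
    thetaX f α z v = (coframe z.toJ1 (jet2 f z) v.toJ1).ux α := by
  change v.xs 0 α - z.xs 1 α * v.x - f z.toJ1 α * v.y
    = v.xs 0 α - v.x * z.xs 1 α - v.y * f z.toJ1 α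
  ring

theorem thetaY_apply (f : J1 m → Fin m → ℝ) (z v : RInf m) (α : Fin m) :
    thetaY f α z v = (coframe z.toJ1 (jet2 f z) v.toJ1).uy α := by
  change v.ys 0 α - f z.toJ1 α * v.x - z.ys 1 α * v.y
    = v.ys 0 α - v.x * f z.toJ1 α - v.y * z.ys 1 α
  ring

/-- This replaces the exterior algebra on the infinite-dimensional tangent space by a polynomial in
coframe components, which depend only on projections to J¹ and on the second-order jet. -/
theorem omega_apply (f : J1 m → Fin m → ℝ) (T S R : RInf m → Matrix (Fin m) (Fin m) ℝ)
    (p : RInf m) (v : Fin 3 → RInf m) :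
    omega f T S R p v = tri (T p) (S p) (R p) (coframe p.toJ1 (jet2 f p) (v 0).toJ1)
      (coframe p.toJ1 (jet2 f p) (v 1).toJ1) (coframe p.toJ1 (jet2 f p) (v 2).toJ1) := by
  have hx : ∀ i, dx (v i) = (coframe p.toJ1 (jet2 f p) (v i).toJ1).x := fun _ => rfl
  have hy : ∀ i, dy (v i) = (coframe p.toJ1 (jet2 f p) (v i).toJ1).y := fun _ => rfl
  have hsum : ∀ g : Fin m → RInf m [⋀^Fin 3]→ₗ[ℝ] ℝ, (∑ α, g α) v = ∑ α, g α v := fun g =>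
    map_sum (⟨⟨fun h : RInf m [⋀^Fin 3]→ₗ[ℝ] ℝ => h v, rfl⟩, fun _ _ => rfl⟩ :
      (RInf m [⋀^Fin 3]→ₗ[ℝ] ℝ) →+ ℝ) g Finset.univ
  simp only [omega, hsum, AlternatingMap.add_apply, AlternatingMap.smul_apply,
    AlternatingMap.sub_apply, wedge3_apply, LinearMap.add_apply, LinearMap.smul_apply, smul_eq_mul,
    hx, hy, theta_apply p (jet2 f p), thetaX_apply, thetaY_apply]
  generalize coframe p.toJ1 (jet2 f p) (v 0).toJ1 = a
  generalize coframe p.toJ1 (jet2 f p) (v 1).toJ1 = b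
  generalize coframe p.toJ1 (jet2 f p) (v 2).toJ1 = c
  simp only [tri, bil, Finset.mul_sum, ← Finset.sum_add_distrib, ← Finset.sum_sub_distrib]
  refine Finset.sum_congr rfl fun α _ => Finset.sum_congr rfl fun β _ => ?_
  ring

/-! ### The Poincaré-Cartan form -/

/-- The vertical vector `a^α ∂/∂u^α`. -/
def vecU : (Fin m → ℝ) →ₗ[ℝ] J1 m where
  toFun a := (0, 0, a, 0, 0)
  map_add' _ _ := by simp
  map_smul' _ _ := by simp

/-- The vertical vector `a^α ∂/∂u^α_x`. -/
def vecUx : (Fin m → ℝ) →ₗ[ℝ] J1 m where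
  toFun a := (0, 0, 0, a, 0)
  map_add' _ _ := by simp
  map_smul' _ _ := by simp

/-- The vertical vector `a^α ∂/∂u^α_y`. -/
def vecUy : (Fin m → ℝ) →ₗ[ℝ] J1 m where
  toFun a := (0, 0, 0, 0, a)
  map_add' _ _ := by simp
  map_smul' _ _ := by simp

/-- The truncated total derivative `D_x` at the jet `(z, w)`. -/
def totX (z : J1 m) (w : Fibre2 m) : J1 m := (1, 0, z.ux, w.uxx, w.uxy)

/-- The truncated total derivative `D_y` at the jet `(z, w)`. -/
def totY (z : J1 m) (w : Fibre2 m) : J1 m := (0, 1, z.uy, w.uxy, w.uyy)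

theorem eq_coframe (z : J1 m) (w : Fibre2 m) (v : J1 m) :
    v = (coframe z w v).x • totX z w + (coframe z w v).y • totY z w + vecU (coframe z w v).u
      + vecUx (coframe z w v).ux + vecUy (coframe z w v).uy := by
  obtain ⟨x, y, u, ux, uy⟩ := v
  simp only [coframe, totX, totY, vecU, vecUx, vecUy, J1.x, J1.y, J1.u, J1.ux, J1.uy,
    LinearMap.coe_mk, AddHom.coe_mk, Prod.smul_mk, Prod.mk_add_mk, Prod.mk.injEq]
  refine ⟨by simp, by simp, ?_, ?_, ?_⟩ <;> · ext; simp

/-- The Poincaré-Cartan form of `L`, `L dx ∧ dy + L_{u_x} θ ∧ dy - L_{u_y} θ ∧ dx`. -/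
def cartan (L : J1 m → ℝ) (z b c : J1 m) : ℝ :=
  L z * (b.x * c.y - b.y * c.x)
    + (fderiv ℝ L z (vecUx (c.y • (b.u - b.x • z.ux - b.y • z.uy)
        - b.y • (c.u - c.x • z.ux - c.y • z.uy)))
      - fderiv ℝ L z (vecUy (c.x • (b.u - b.x • z.ux - b.y • z.uy)
        - b.x • (c.u - c.x • z.ux - c.y • z.uy))))

/-- The derivative of `cartan L · b c` in the direction `a`. -/
def dirCartan (L : J1 m → ℝ) (z a b c : J1 m) : ℝ :=
  fderiv ℝ L z a * (b.x * c.y - b.y * c.x)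
    + (fderiv ℝ (fderiv ℝ L) z a (vecUx (c.y • (b.u - b.x • z.ux - b.y • z.uy)
        - b.y • (c.u - c.x • z.ux - c.y • z.uy)))
      - fderiv ℝ (fderiv ℝ L) z a (vecUy (c.x • (b.u - b.x • z.ux - b.y • z.uy)
        - b.x • (c.u - c.x • z.ux - c.y • z.uy))))
    + (fderiv ℝ L z (vecUx (c.y • (- b.x • a.ux - b.y • a.uy)
        - b.y • (- c.x • a.ux - c.y • a.uy)))
      - fderiv ℝ L z (vecUy (c.x • (- b.x • a.ux - b.y • a.uy)
        - b.x • (- c.x • a.ux - c.y • a.uy))))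

/-- The exterior derivative of the Poincaré-Cartan form. -/
def dCartan (L : J1 m → ℝ) (z a b c : J1 m) : ℝ :=
  dirCartan L z a b c - dirCartan L z b a c + dirCartan L z c a b

/-- The contraction of the Euler-Lagrange expression with a vector. -/
def el (L : J1 m → ℝ) (z : J1 m) (w : Fibre2 m) (a : Fin m → ℝ) : ℝ :=
  fderiv ℝ L z (vecU a) - fderiv ℝ (fderiv ℝ L) z (totX z w) (vecUx a)
    - fderiv ℝ (fderiv ℝ L) z (totY z w) (vecUy a)

/-- The coefficient `T_{αβ} = -∂²L/∂u^α∂u^β_y` of the exterior derivative of `cartan L`. -/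
def lagT (L : J1 m → ℝ) (z : J1 m) : Matrix (Fin m) (Fin m) ℝ := fun α β =>
  -fderiv ℝ (fderiv ℝ L) z (vecU (Pi.single α 1)) (vecUy (Pi.single β 1))

/-- The coefficient `S_{αβ} = ∂²L/∂u^α∂u^β_x` of the exterior derivative of `cartan L`. -/
def lagS (L : J1 m → ℝ) (z : J1 m) : Matrix (Fin m) (Fin m) ℝ := fun α β =>
  fderiv ℝ (fderiv ℝ L) z (vecU (Pi.single α 1)) (vecUx (Pi.single β 1))

/-- The coefficient `R_{αβ} = ∂²L/∂u^β_x∂u^α_y` of the exterior derivative of `cartan L`. -/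
def lagR (L : J1 m → ℝ) (z : J1 m) : Matrix (Fin m) (Fin m) ℝ := fun α β =>
  fderiv ℝ (fderiv ℝ L) z (vecUx (Pi.single β 1)) (vecUy (Pi.single α 1))

theorem bil_of_clm (A : Matrix (Fin m) (Fin m) ℝ) (D : J1 m →L[ℝ] J1 m →L[ℝ] ℝ)
    (i j : (Fin m → ℝ) →ₗ[ℝ] J1 m)
    (h : ∀ α β, A α β = D (i (Pi.single α 1)) (j (Pi.single β 1))) (a b : Fin m → ℝ) :
    bil A a b = D (i a) (j b) :=
  bil_eq_of_linear A (LinearMap.mk₂ ℝ (fun a b => D (i a) (j b)) (by simp) (by simp) (by simp)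
    (by simp)) h a b

theorem bil_lagT (L : J1 m → ℝ) (z : J1 m) (a b : Fin m → ℝ) :
    bil (lagT L z) a b = -fderiv ℝ (fderiv ℝ L) z (vecU a) (vecUy b) :=
  bil_of_clm (lagT L z) (-fderiv ℝ (fderiv ℝ L) z) vecU vecUy (fun _ _ => rfl) a b

theorem bil_lagS (L : J1 m → ℝ) (z : J1 m) (a b : Fin m → ℝ) :
    bil (lagS L z) a b = fderiv ℝ (fderiv ℝ L) z (vecU a) (vecUx b) :=
  bil_of_clm (lagS L z) (fderiv ℝ (fderiv ℝ L) z) vecU vecUx (fun _ _ => rfl) a b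

theorem bil_lagR (L : J1 m → ℝ) (z : J1 m) (a b : Fin m → ℝ) :
    bil (lagR L z) a b = fderiv ℝ (fderiv ℝ L) z (vecUx b) (vecUy a) :=
  bil_of_clm (lagR L z) (fderiv ℝ (fderiv ℝ L) z).flip vecUy vecUx (fun _ _ => rfl) a b

/-- Expanding every vector in the frame dual to the coframe leaves only the ω-shaped terms and
E_α(L) θ^α∧dx∧dy; `hxx` and `hyy` remove the θ∧θ_x∧dy and θ∧θ_y∧dx terms. The left side does not
involve the second-order jet w, so w may be chosen freely, in particular on the equation. -/
theorem dCartan_eq {L : J1 m → ℝ} {z : J1 m}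
    (hsymm : ∀ a b, fderiv ℝ (fderiv ℝ L) z a b = fderiv ℝ (fderiv ℝ L) z b a)
    (hxx : ∀ a b, fderiv ℝ (fderiv ℝ L) z (vecUx a) (vecUx b) = 0)
    (hyy : ∀ a b, fderiv ℝ (fderiv ℝ L) z (vecUy a) (vecUy b) = 0) (w : Fibre2 m) (a b c : J1 m) :
    dCartan L z a b c = tri (lagT L z) (lagS L z) (lagR L z) (coframe z w a) (coframe z w b)
        (coframe z w c)
      + (el L z w (coframe z w a).u * (b.x * c.y - b.y * c.x)
        + el L z w (coframe z w b).u * (c.x * a.y - c.y * a.x)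
        + el L z w (coframe z w c).u * (a.x * b.y - a.y * b.x)) := by
  have hth : ∀ v : J1 m, v.u - v.x • z.ux - v.y • z.uy = (coframe z w v).u := fun _ => rfl
  have hvx : ∀ v : J1 m, v.x = (coframe z w v).x := fun _ => rfl
  have hvy : ∀ v : J1 m, v.y = (coframe z w v).y := fun _ => rfl
  have hux : ∀ v : J1 m, v.ux = (coframe z w v).ux + (coframe z w v).x • w.uxx
      + (coframe z w v).y • w.uxy := fun v => by
    simp only [coframe, J1.x, J1.y, J1.ux]; abel
  have huy : ∀ v : J1 m, v.uy = (coframe z w v).uy + (coframe z w v).x • w.uxy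
      + (coframe z w v).y • w.uyy := fun v => by
    simp only [coframe, J1.x, J1.y, J1.uy]; abel
  have hD : ∀ v : J1 m, fderiv ℝ L z v = _ := fun v => congrArg (fderiv ℝ L z) (eq_coframe z w v)
  have hD2 : ∀ v : J1 m, fderiv ℝ (fderiv ℝ L) z v = _ := fun v =>
    congrArg (fderiv ℝ (fderiv ℝ L) z) (eq_coframe z w v)
  simp only [dCartan, dirCartan, hth]
  -- Only the directions of differentiation and the components u_x, u_y are expanded; the arguments
  -- that are already θ-components stay as they are.
  rw [hD a, hD b, hD c, hD2 a, hD2 b, hD2 c, hux a, huy a, hux b, huy b, hux c, huy c]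
  rw [hvx a, hvx b, hvx c, hvy a, hvy b, hvy c]
  generalize coframe z w a = a
  generalize coframe z w b = b
  generalize coframe z w c = c
  simp only [tri, bil_lagT, bil_lagS, bil_lagR, el, map_add, map_sub, map_smul,
    add_apply, smul_apply, smul_eq_mul, hxx, hyy, neg_smul, map_neg,
    hsymm (vecUy _) (vecUx _)]
  ring

/-- The projection `z ↦ z.ux` as a continuous linear map. -/
def uxL : J1 m →L[ℝ] (Fin m → ℝ) :=
  (ContinuousLinearMap.fst ℝ (Fin m → ℝ) (Fin m → ℝ)).comp
    ((ContinuousLinearMap.snd ℝ (Fin m → ℝ) ((Fin m → ℝ) × (Fin m → ℝ))).comp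
      ((ContinuousLinearMap.snd ℝ ℝ _).comp (ContinuousLinearMap.snd ℝ ℝ _)))

/-- The projection `z ↦ z.uy` as a continuous linear map. -/
def uyL : J1 m →L[ℝ] (Fin m → ℝ) :=
  (ContinuousLinearMap.snd ℝ (Fin m → ℝ) (Fin m → ℝ)).comp
    ((ContinuousLinearMap.snd ℝ (Fin m → ℝ) ((Fin m → ℝ) × (Fin m → ℝ))).comp
      ((ContinuousLinearMap.snd ℝ ℝ _).comp (ContinuousLinearMap.snd ℝ ℝ _)))

theorem hasFDerivAt_ux (z : J1 m) : HasFDerivAt (fun y : J1 m => y.ux) uxL z :=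
  uxL.hasFDerivAt

theorem hasFDerivAt_uy (z : J1 m) : HasFDerivAt (fun y : J1 m => y.uy) uyL z :=
  uyL.hasFDerivAt

theorem hasFDerivAt_theta_combination (ψ : (Fin m → ℝ) →ₗ[ℝ] J1 m) (r s : ℝ) (b c z : J1 m) :
    HasFDerivAt (fun y : J1 m => ψ (r • (b.u - b.x • y.ux - b.y • y.uy)
      - s • (c.u - c.x • y.ux - c.y • y.uy)))
      (ψ.toContinuousLinearMap.comp (r • (0 - b.x • uxL - b.y • uyL)
        - s • (0 - c.x • uxL - c.y • uyL))) z := by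
  have h : ∀ v : J1 m, HasFDerivAt (fun y : J1 m => v.u - v.x • y.ux - v.y • y.uy)
      (0 - v.x • uxL - v.y • uyL) z := fun v =>
    ((hasFDerivAt_const v.u z).sub ((hasFDerivAt_ux z).const_smul v.x)).sub
      ((hasFDerivAt_uy z).const_smul v.y)
  exact ψ.toContinuousLinearMap.hasFDerivAt.comp z
    (((h b).const_smul r).sub ((h c).const_smul s))

theorem contDiff_theta_combination (ψ : (Fin m → ℝ) →ₗ[ℝ] J1 m) (r s : ℝ) (b c : J1 m) :
    ContDiff ℝ ∞ (fun y : J1 m => ψ (r • (b.u - b.x • y.ux - b.y • y.uy)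
      - s • (c.u - c.x • y.ux - c.y • y.uy))) := by
  have h : ∀ v : J1 m, ContDiff ℝ ∞ (fun y : J1 m => v.u - v.x • y.ux - v.y • y.uy) := fun v =>
    (contDiff_const.sub (uxL.contDiff.const_smul v.x)).sub (uyL.contDiff.const_smul v.y)
  exact ψ.toContinuousLinearMap.contDiff.comp
    (((h b).const_smul r).sub ((h c).const_smul s))

theorem contDiffAt_fderiv {E F : Type*} [NormedAddCommGroup E] [NormedSpace ℝ E]
    [NormedAddCommGroup F] [NormedSpace ℝ F] {g : E → F} {z : E} (hg : ContDiffAt ℝ ∞ g z) :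
    ContDiffAt ℝ ∞ (fderiv ℝ g) z :=
  hg.fderiv_right (by simp)

theorem contDiffAt_cartan {L : J1 m → ℝ} {z : J1 m} (hL : ContDiffAt ℝ ∞ L z) (b c : J1 m) :
    ContDiffAt ℝ ∞ (fun y => cartan L y b c) z :=
  (hL.mul contDiffAt_const).add
    (((contDiffAt_fderiv hL).clm_apply (contDiff_theta_combination vecUx _ _ b c).contDiffAt).sub
      ((contDiffAt_fderiv hL).clm_apply (contDiff_theta_combination vecUy _ _ b c).contDiffAt))

theorem fderiv_cartan {L : J1 m → ℝ} {z : J1 m} (hL : ContDiffAt ℝ ∞ L z) (a b c : J1 m) :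
    fderiv ℝ (fun y => cartan L y b c) z a = dirCartan L z a b c := by
  have h0 : HasFDerivAt L (fderiv ℝ L z) z := (hL.differentiableAt (by simp)).hasFDerivAt
  have h1 : HasFDerivAt (fderiv ℝ L) (fderiv ℝ (fderiv ℝ L) z) z :=
    ((contDiffAt_fderiv hL).differentiableAt (by simp)).hasFDerivAt
  have h := (h0.mul_const (b.x * c.y - b.y * c.x)).add
    ((h1.clm_apply (hasFDerivAt_theta_combination vecUx c.y b.y b c z)).sub
      (h1.clm_apply (hasFDerivAt_theta_combination vecUy c.x b.x b c z)))
  have e : fderiv ℝ (fun y => cartan L y b c) z = _ := HasFDerivAt.fderiv h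
  have ex : (uxL : J1 m →L[ℝ] _) a = a.ux := rfl
  have ey : (uyL : J1 m →L[ℝ] _) a = a.uy := rfl
  rw [e]
  simp only [dirCartan, add_apply, sub_apply, neg_apply, smul_apply,
    ContinuousLinearMap.comp_apply, ContinuousLinearMap.flip_apply,
    LinearMap.coe_toContinuousLinearMap', ex, ey, smul_eq_mul, zero_sub, neg_smul]
  ring

theorem dCartan_eventuallyEq {L : J1 m → ℝ} {z : J1 m}
    (hL : ∀ᶠ y in 𝓝 z, ContDiffAt ℝ ∞ L y) (a b c : J1 m) :
    (fun y => dCartan L y a b c) =ᶠ[𝓝 z] fun y => fderiv ℝ (fun y => cartan L y b c) y a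
      - fderiv ℝ (fun y => cartan L y a c) y b + fderiv ℝ (fun y => cartan L y a b) y c := by
  filter_upwards [hL] with y hy
  simp only [dCartan, fderiv_cartan hy]

theorem contDiffAt_dCartan {L : J1 m → ℝ} {z : J1 m}
    (hL : ∀ᶠ y in 𝓝 z, ContDiffAt ℝ ∞ L y) (a b c : J1 m) :
    ContDiffAt ℝ ∞ (fun y => dCartan L y a b c) z := by
  refine ContDiffAt.congr_of_eventuallyEq ?_ (dCartan_eventuallyEq hL a b c)
  have h : ∀ a b c, ContDiffAt ℝ ∞ (fun y => fderiv ℝ (fun y => cartan L y b c) y a) z :=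
    fun a b c => (contDiffAt_fderiv (contDiffAt_cartan hL.self_of_nhds b c)).clm_apply contDiffAt_const
  exact ((h a b c).sub (h b a c)).add (h c a b)

theorem dCartan_closed {L : J1 m → ℝ} {z : J1 m}
    (hL : ∀ᶠ y in 𝓝 z, ContDiffAt ℝ ∞ L y) (a b c d : J1 m) :
    fderiv ℝ (fun y => dCartan L y b c d) z a - fderiv ℝ (fun y => dCartan L y a c d) z b
      + fderiv ℝ (fun y => dCartan L y a b d) z c - fderiv ℝ (fun y => dCartan L y a b c) z d = 0 :=
  threeForm_extDeriv_eq_zero (B := cartan L)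
    (fun b c => (contDiffAt_cartan hL.self_of_nhds b c).of_le (by norm_cast)) (dCartan L)
    (dCartan_eventuallyEq hL) a b c d

/-! ### Forms on `R^∞` -/

theorem extD_apply_four (η : DForm m 3) (p : RInf m) (v : Fin 4 → RInf m) :
    extD η p v = lineDeriv ℝ (fun q => η q ![v 1, v 2, v 3]) p (v 0)
      - lineDeriv ℝ (fun q => η q ![v 0, v 2, v 3]) p (v 1)
      + lineDeriv ℝ (fun q => η q ![v 0, v 1, v 3]) p (v 2)
      - lineDeriv ℝ (fun q => η q ![v 0, v 1, v 2]) p (v 3) := by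
  have h0 : (0 : Fin 4).removeNth v = ![v 1, v 2, v 3] := by
    funext i; fin_cases i <;> rfl
  have h1 : (1 : Fin 4).removeNth v = ![v 0, v 2, v 3] := by
    funext i; fin_cases i <;> rfl
  have h2 : (2 : Fin 4).removeNth v = ![v 0, v 1, v 3] := by
    funext i; fin_cases i <;> rfl
  have h3 : (3 : Fin 4).removeNth v = ![v 0, v 1, v 2] := by
    funext i; fin_cases i <;> rfl
  rw [extD, Fin.sum_univ_four, h0, h1, h2, h3]
  simp
  ring

theorem continuous_toJ1 : Continuous (RInf.toJ1 : RInf m → J1 m) := by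
  unfold RInf.toJ1 RInf.x RInf.y RInf.u RInf.xs RInf.ys
  fun_prop

theorem hasLineDerivAt_comp_toJ1 {g : J1 m → ℝ} {p : RInf m}
    (hg : DifferentiableAt ℝ g p.toJ1) (v : RInf m) :
    HasLineDerivAt ℝ (fun q : RInf m => g q.toJ1) (fderiv ℝ g p.toJ1 v.toJ1) p v := by
  have h : HasLineDerivAt ℝ g (fderiv ℝ g p.toJ1 v.toJ1) p.toJ1 v.toJ1 :=
    hg.hasFDerivAt.hasLineDerivAt _
  exact h

/-- Lines are continuous in the product topology, so agreement near p is seen along every line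
through p. -/
theorem lineDeriv_congr_of_eventuallyEq {g h : RInf m → ℝ} {p v : RInf m} (hgh : g =ᶠ[𝓝 p] h) :
    lineDeriv ℝ g p v = lineDeriv ℝ h p v := by
  have hc : Filter.Tendsto (fun t : ℝ => p + t • v) (𝓝 0) (𝓝 p) := by
    have : Continuous fun t : ℝ => p + t • v := by fun_prop
    simpa using this.tendsto 0
  exact Filter.EventuallyEq.deriv_eq (hc.eventually hgh)

theorem smoothOn_comp_toJ1 {g : J1 m → ℝ} {U : Set (J1 m)} (hU : IsOpen U)
    (hg : ContDiffOn ℝ ∞ g U) : SmoothOn (fun p => g p.toJ1) (RInf.toJ1 ⁻¹' U) := by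
  intro p hp
  let s : RFin m 1 → J1 m := fun q => (q.1, q.2.1, q.2.2.1, q.2.2.2.1 0, q.2.2.2.2 0)
  have hs : ContDiff ℝ ∞ s := by fun_prop
  refine ⟨1, fun q => g (s q), ?_, Filter.Eventually.of_forall fun q => rfl⟩
  exact ContDiffAt.comp _ (hg.contDiffAt (hU.mem_nhds hp)) hs.contDiffAt

/-! ### From a Lagrangian to a closed form -/

theorem fderiv_pU {g : J1 m → ℝ} {z : J1 m} (hg : ContDiffAt ℝ ∞ g z) (a b : J1 m) :
    fderiv ℝ (fun y => fderiv ℝ g y b) z a = fderiv ℝ (fderiv ℝ g) z a b := by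
  rw [fderiv_clm_apply ((contDiffAt_fderiv hg).differentiableAt (by simp))
    (differentiableAt_const b)]
  simp

theorem eulerLagrange_eq_el {L : J1 m → ℝ} {z : J1 m} (hL : ContDiffAt ℝ ∞ L z) (w : Fibre2 m)
    (α : Fin m) : eulerLagrange L α z w = el L z w (Pi.single α 1) := by
  have hx : Dx (pUx α L) z w
      = fderiv ℝ (fderiv ℝ L) z (totX z w) (vecUx (Pi.single α 1)) := fderiv_pU hL _ _
  have hy : Dy (pUy α L) z w
      = fderiv ℝ (fderiv ℝ L) z (totY z w) (vecUy (Pi.single α 1)) := fderiv_pU hL _ _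
  rw [eulerLagrange, hx, hy]
  rfl

theorem el_eq_sum (L : J1 m → ℝ) (z : J1 m) (w : Fibre2 m) (a : Fin m → ℝ) :
    el L z w a = ∑ α, a α * el L z w (Pi.single α 1) := by
  let φ : (Fin m → ℝ) →ₗ[ℝ] ℝ :=
    (fderiv ℝ L z).toLinearMap.comp vecU
      - (fderiv ℝ (fderiv ℝ L) z (totX z w)).toLinearMap.comp vecUx
      - (fderiv ℝ (fderiv ℝ L) z (totY z w)).toLinearMap.comp vecUy
  change φ a = ∑ α, a α * φ (Pi.single α 1)
  conv_lhs => rw [pi_eq_sum_univ' a]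
  simp

theorem totX_eq (z : J1 m) (w : Fibre2 m) :
    totX z w = ((1 : ℝ), (0 : ℝ), z.ux, (0 : Fin m → ℝ), (0 : Fin m → ℝ)) + vecUx w.uxx
      + vecUy w.uxy := by
  simp [totX, vecUx, vecUy]

theorem totY_eq (z : J1 m) (w : Fibre2 m) :
    totY z w = ((0 : ℝ), (1 : ℝ), z.uy, (0 : Fin m → ℝ), (0 : Fin m → ℝ)) + vecUx w.uxy
      + vecUy w.uyy := by
  simp [totY, vecUx, vecUy]

theorem fderiv_fderiv_symm {L : J1 m → ℝ} {z : J1 m} (hL : ContDiffAt ℝ ∞ L z) (a b : J1 m) :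
    fderiv ℝ (fderiv ℝ L) z a b = fderiv ℝ (fderiv ℝ L) z b a :=
  (hL.isSymmSndFDerivAt (by rw [minSmoothness_of_isRCLikeNormedField]; norm_cast)).eq a b

theorem clm_eq_zero_of_single (D : J1 m →L[ℝ] J1 m →L[ℝ] ℝ) (i : (Fin m → ℝ) →ₗ[ℝ] J1 m)
    (h : ∀ a α, D (i a) (i (Pi.single α 1)) = 0) (a b : Fin m → ℝ) : D (i a) (i b) = 0 := by
  rw [pi_eq_sum_univ' b]
  simp [h]

/-- The form is dΘ_L pulled back to R^∞; it is closed because d² = 0. -/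
theorem HasFirstOrderMultiplier.hasClosedForm {f : J1 m → Fin m → ℝ} {U : Set (J1 m)}
    (hU : IsOpen U) (h : HasFirstOrderMultiplier f U) : HasClosedForm f U := by
  obtain ⟨M, L, -, hL, hdet, hEL⟩ := h
  have hLz : ∀ z ∈ U, ContDiffAt ℝ ∞ L z := fun z hz => hL.contDiffAt (hU.mem_nhds hz)
  have hLe : ∀ z ∈ U, ∀ᶠ y in 𝓝 z, ContDiffAt ℝ ∞ L y := fun z hz =>
    Filter.mem_of_superset (hU.mem_nhds hz) hLz
  have hE : ∀ z ∈ U, ∀ w α, el L z w (Pi.single α 1) = ∑ β, M z α β * (w.uxy β - f z β) :=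
    fun z hz w α => by rw [← eulerLagrange_eq_el (hLz z hz), hEL z hz]
  -- The multiplier equation has no u_xx on its right side, so its values at u_xx = a and at u_xx =
  -- 0 agree; their difference is the Hessian of L in u_x.
  have hxx : ∀ z ∈ U, ∀ a b, fderiv ℝ (fderiv ℝ L) z (vecUx a) (vecUx b) = 0 := by
    intro z hz
    refine clm_eq_zero_of_single _ _ fun a α => ?_
    have h1 := hE z hz ⟨a, 0, 0⟩ α
    have h2 := hE z hz ⟨0, 0, 0⟩ α
    rw [← h2] at h1
    simp only [el, totX_eq, totY_eq, map_add, map_zero, add_apply, zero_apply] at h1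
    linarith
  have hyy : ∀ z ∈ U, ∀ a b, fderiv ℝ (fderiv ℝ L) z (vecUy a) (vecUy b) = 0 := by
    intro z hz
    refine clm_eq_zero_of_single _ _ fun a α => ?_
    have h1 := hE z hz ⟨0, 0, a⟩ α
    have h2 := hE z hz ⟨0, 0, 0⟩ α
    rw [← h2] at h1
    simp only [el, totX_eq, totY_eq, map_add, map_zero, add_apply, zero_apply] at h1
    linarith
  -- Comparison of the coefficients of u_xy^β.
  have hR : ∀ z ∈ U, lagR L z + (lagR L z).transpose = -M z := by
    intro z hz
    ext α β
    have h1 := hE z hz ⟨0, Pi.single β 1, 0⟩ α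
    have h2 := hE z hz ⟨0, 0, 0⟩ α
    have h3 : ∑ γ, M z α γ * ((Pi.single β 1 : Fin m → ℝ) γ - f z γ)
        = M z α β + ∑ γ, M z α γ * ((0 : Fin m → ℝ) γ - f z γ) := by
      simp [mul_sub, Finset.sum_sub_distrib, Pi.single_apply]
      ring
    simp only [h3] at h1
    rw [← h2] at h1
    simp only [el, totX_eq, totY_eq, map_add, map_zero, add_apply, zero_apply] at h1
    rw [fderiv_fderiv_symm (hLz z hz) (vecUy _) (vecUx _)] at h1
    simp only [Matrix.add_apply, Matrix.transpose_apply, Matrix.neg_apply, lagR]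
    linarith
  have hform : ∀ p ∈ RInf.toJ1 ⁻¹' U, ∀ v : Fin 3 → RInf m,
      omega f (fun p => lagT L p.toJ1) (fun p => lagS L p.toJ1) (fun p => lagR L p.toJ1) p v
        = dCartan L p.toJ1 (v 0).toJ1 (v 1).toJ1 (v 2).toJ1 := by
    intro p hp v
    -- The jet `jet2 f p` satisfies u_xy = f, so the Euler-Lagrange term drops out.
    have hE0 : ∀ a, el L p.toJ1 (jet2 f p) a = 0 := fun a => by
      rw [el_eq_sum]
      simp [hE _ hp, jet2]
    rw [omega_apply, dCartan_eq (fderiv_fderiv_symm (hLz _ hp)) (hxx _ hp) (hyy _ hp) (jet2 f p)]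
    simp [hE0]
  have hD2 : ∀ a b, ContDiffOn ℝ ∞ (fun z => fderiv ℝ (fderiv ℝ L) z a b) U := fun a b z hz =>
    (((contDiffAt_fderiv (contDiffAt_fderiv (hLz z hz))).clm_apply contDiffAt_const).clm_apply
      contDiffAt_const).contDiffWithinAt
  refine ⟨fun p => lagT L p.toJ1, fun p => lagS L p.toJ1, fun p => lagR L p.toJ1, ?_, ?_, ?_, ?_, ?_⟩
  · exact fun α β => smoothOn_comp_toJ1 hU (hD2 _ _).neg
  · exact fun α β => smoothOn_comp_toJ1 hU (hD2 _ _)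
  · exact fun α β => smoothOn_comp_toJ1 hU (hD2 _ _)
  · intro p hp
    rw [hR _ hp, Matrix.det_neg]
    exact mul_ne_zero (pow_ne_zero _ (by norm_num)) (hdet _ hp)
  · intro p hp v
    have hO : RInf.toJ1 ⁻¹' U ∈ 𝓝 p := (hU.preimage continuous_toJ1).mem_nhds hp
    have hd : ∀ a b c e, lineDeriv ℝ (fun q => omega f (fun p => lagT L p.toJ1)
        (fun p => lagS L p.toJ1) (fun p => lagR L p.toJ1) q ![a, b, c]) p e
        = fderiv ℝ (fun y => dCartan L y a.toJ1 b.toJ1 c.toJ1) p.toJ1 e.toJ1 := by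
      intro a b c e
      rw [lineDeriv_congr_of_eventuallyEq (Filter.mem_of_superset hO fun q hq => hform q hq _)]
      exact (hasLineDerivAt_comp_toJ1
        ((contDiffAt_dCartan (hLe _ hp) _ _ _).differentiableAt (by simp)) e).lineDeriv
    rw [extD_apply_four, hd, hd, hd, hd]
    exact dCartan_closed (hLe _ hp) _ _ _ _

/-! ### Lagrangians that are bilinear on the total derivatives -/

/-- The vector `a^α ∂/∂u^α` on `J⁰`. -/
def vecU0 : (Fin m → ℝ) →L[ℝ] J0 m :=
  (ContinuousLinearMap.inr ℝ ℝ (ℝ × (Fin m → ℝ))).comp (ContinuousLinearMap.inr ℝ ℝ (Fin m → ℝ))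

theorem vecU0_apply (a : Fin m → ℝ) : vecU0 a = ((0, 0, a) : J0 m) := rfl

/-- The projection `J¹ → J⁰` as a continuous linear map. -/
def toJ0L : J1 m →L[ℝ] J0 m :=
  (ContinuousLinearMap.fst ℝ _ _).prod
    (((ContinuousLinearMap.fst ℝ _ _).comp (ContinuousLinearMap.snd ℝ _ _)).prod
      ((ContinuousLinearMap.fst ℝ _ _).comp
        ((ContinuousLinearMap.snd ℝ _ _).comp (ContinuousLinearMap.snd ℝ _ _))))

theorem toJ0L_apply (z : J1 m) : toJ0L z = z.toJ0 := rfl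

/-- The vector `∂/∂x + u_x^α ∂/∂u^α`. -/
def tot0X (z : J1 m) : J0 m := (1, 0, z.ux)

/-- The vector `∂/∂y + u_y^α ∂/∂u^α`. -/
def tot0Y (z : J1 m) : J0 m := (0, 1, z.uy)

theorem hasFDerivAt_tot0X (z : J1 m) : HasFDerivAt tot0X (vecU0.comp uxL) z := by
  have h : (tot0X : J1 m → J0 m) = fun y => (1, 0, 0) + (vecU0.comp uxL) y := by
    ext y <;> simp [tot0X, vecU0, uxL, J1.ux]
  rw [h]
  exact (vecU0.comp uxL).hasFDerivAt.const_add _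

theorem hasFDerivAt_tot0Y (z : J1 m) : HasFDerivAt tot0Y (vecU0.comp uyL) z := by
  have h : (tot0Y : J1 m → J0 m) = fun y => (0, 1, 0) + (vecU0.comp uyL) y := by
    ext y <;> simp [tot0Y, vecU0, uyL, J1.uy]
  rw [h]
  exact (vecU0.comp uyL).hasFDerivAt.const_add _

theorem contDiff_tot0X : ContDiff ℝ ∞ (tot0X : J1 m → J0 m) :=
  contDiff_const.prodMk (contDiff_const.prodMk uxL.contDiff)

theorem contDiff_tot0Y : ContDiff ℝ ∞ (tot0Y : J1 m → J0 m) :=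
  contDiff_const.prodMk (contDiff_const.prodMk uyL.contDiff)

/-- The Lagrangian `γ(∂_x + u_x ∂_u, ∂_y + u_y ∂_u)` of a bilinear form `γ` on `J⁰`. -/
def bilLag (γ : J0 m → J0 m →L[ℝ] J0 m →L[ℝ] ℝ) (z : J1 m) : ℝ :=
  γ z.toJ0 (tot0X z) (tot0Y z)

section bilLag

variable {γ : J0 m → J0 m →L[ℝ] J0 m →L[ℝ] ℝ} {z : J1 m}

theorem hasFDerivAt_comp_toJ0 (hγ : ContDiffAt ℝ ∞ γ z.toJ0) :
    HasFDerivAt (fun y : J1 m => γ y.toJ0) ((fderiv ℝ γ z.toJ0).comp toJ0L) z :=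
  HasFDerivAt.comp (f := toJ0L) z (hγ.differentiableAt (by simp)).hasFDerivAt toJ0L.hasFDerivAt

theorem contDiffAt_bilLag (hγ : ContDiffAt ℝ ∞ γ z.toJ0) : ContDiffAt ℝ ∞ (bilLag γ) z :=
  ((ContDiffAt.comp (f := toJ0L) z hγ toJ0L.contDiff.contDiffAt).clm_apply
    contDiff_tot0X.contDiffAt).clm_apply contDiff_tot0Y.contDiffAt

theorem fderiv_bilLag (hγ : ContDiffAt ℝ ∞ γ z.toJ0) (e : J1 m) :
    fderiv ℝ (bilLag γ) z e = fderiv ℝ γ z.toJ0 e.toJ0 (tot0X z) (tot0Y z)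
      + γ z.toJ0 (vecU0 e.ux) (tot0Y z) + γ z.toJ0 (tot0X z) (vecU0 e.uy) := by
  have h := (((hasFDerivAt_comp_toJ0 hγ).clm_apply (hasFDerivAt_tot0X z)).clm_apply
    (hasFDerivAt_tot0Y z))
  have e1 : fderiv ℝ (bilLag γ) z = _ := HasFDerivAt.fderiv h
  have ex : (uxL : J1 m →L[ℝ] _) e = e.ux := rfl
  have ey : (uyL : J1 m →L[ℝ] _) e = e.uy := rfl
  rw [e1]
  simp only [add_apply, ContinuousLinearMap.comp_apply, ContinuousLinearMap.flip_apply, ex, ey,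
    toJ0L_apply]
  ring

theorem eventually_toJ0 {p : J0 m → Prop} (h : ∀ᶠ y in 𝓝 z.toJ0, p y) :
    ∀ᶠ y : J1 m in 𝓝 z, p y.toJ0 :=
  (toJ0L.continuous.tendsto z).eventually h

theorem fderiv_fderiv_bilLag_vecUx (hγ : ∀ᶠ y in 𝓝 z.toJ0, ContDiffAt ℝ ∞ γ y) (e : J1 m)
    (a : Fin m → ℝ) :
    fderiv ℝ (fderiv ℝ (bilLag γ)) z e (vecUx a)
      = fderiv ℝ γ z.toJ0 e.toJ0 (vecU0 a) (tot0Y z) + γ z.toJ0 (vecU0 a) (vecU0 e.uy) := by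
  rw [← fderiv_pU (contDiffAt_bilLag hγ.self_of_nhds)]
  have h1 : (fun y => fderiv ℝ (bilLag γ) y (vecUx a)) =ᶠ[𝓝 z]
      fun y => γ y.toJ0 (vecU0 a) (tot0Y y) := by
    filter_upwards [eventually_toJ0 hγ] with y hy
    rw [fderiv_bilLag hy]
    have e0 : (vecUx a : J1 m).toJ0 = 0 := rfl
    have e1 : vecU0 (vecUx a : J1 m).uy = (0 : J0 m) := rfl
    rw [e0, e1]
    simp
    rfl
  have h2 := (((hasFDerivAt_comp_toJ0 hγ.self_of_nhds).clm_apply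
    (hasFDerivAt_const (vecU0 a) z)).clm_apply (hasFDerivAt_tot0Y z))
  have ey : (uyL : J1 m →L[ℝ] _) e = e.uy := rfl
  rw [h1.fderiv_eq, h2.fderiv]
  simp [ey, toJ0L_apply]
  ring

theorem fderiv_fderiv_bilLag_vecUy (hγ : ∀ᶠ y in 𝓝 z.toJ0, ContDiffAt ℝ ∞ γ y) (e : J1 m)
    (a : Fin m → ℝ) :
    fderiv ℝ (fderiv ℝ (bilLag γ)) z e (vecUy a)
      = fderiv ℝ γ z.toJ0 e.toJ0 (tot0X z) (vecU0 a) + γ z.toJ0 (vecU0 e.ux) (vecU0 a) := by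
  rw [← fderiv_pU (contDiffAt_bilLag hγ.self_of_nhds)]
  have h1 : (fun y => fderiv ℝ (bilLag γ) y (vecUy a)) =ᶠ[𝓝 z]
      fun y => γ y.toJ0 (tot0X y) (vecU0 a) := by
    filter_upwards [eventually_toJ0 hγ] with y hy
    rw [fderiv_bilLag hy]
    have e0 : (vecUy a : J1 m).toJ0 = 0 := rfl
    have e1 : vecU0 (vecUy a : J1 m).ux = (0 : J0 m) := rfl
    rw [e0, e1]
    simp
    rfl
  have h2 := (((hasFDerivAt_comp_toJ0 hγ.self_of_nhds).clm_apply
    (hasFDerivAt_tot0X z)).clm_apply (hasFDerivAt_const (vecU0 a) z))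
  have ex : (uxL : J1 m →L[ℝ] _) e = e.ux := rfl
  rw [h1.fderiv_eq, h2.fderiv]
  simp [ex, toJ0L_apply]
  ring

/-- The jet enters only through u_xy, paired with the symmetric part of γ. If γ is alternating near
the point, those two terms cancel and the first three make up dγ(∂_u, D_x, D_y). -/
theorem el_bilLag (hγ : ∀ᶠ y in 𝓝 z.toJ0, ContDiffAt ℝ ∞ γ y) (w : Fibre2 m) (a : Fin m → ℝ) :
    el (bilLag γ) z w a = fderiv ℝ γ z.toJ0 (vecU0 a) (tot0X z) (tot0Y z)
      - fderiv ℝ γ z.toJ0 (tot0X z) (vecU0 a) (tot0Y z)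
      - fderiv ℝ γ z.toJ0 (tot0Y z) (tot0X z) (vecU0 a)
      - γ z.toJ0 (vecU0 a) (vecU0 w.uxy) - γ z.toJ0 (vecU0 w.uxy) (vecU0 a) := by
  rw [el, fderiv_fderiv_bilLag_vecUx hγ, fderiv_fderiv_bilLag_vecUy hγ,
    fderiv_bilLag hγ.self_of_nhds]
  have e1 : (vecU a : J1 m).toJ0 = vecU0 a := rfl
  have e2 : vecU0 (vecU a : J1 m).ux = (0 : J0 m) := rfl
  have e3 : vecU0 (vecU a : J1 m).uy = (0 : J0 m) := rfl
  have e4 : (totX z w).toJ0 = tot0X z := rfl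
  have e5 : (totY z w).toJ0 = tot0Y z := rfl
  have e6 : (totX z w).uy = w.uxy := rfl
  have e7 : (totY z w).ux = w.uxy := rfl
  rw [e1, e2, e3, e4, e5, e6, e7]
  simp
  ring

end bilLag

/-- The bilinear form `(v, w) ↦ A_{αβ} w^α v^β` on `J⁰`. -/
def matForm (A : Matrix (Fin m) (Fin m) ℝ) : J0 m →L[ℝ] J0 m →L[ℝ] ℝ :=
  ∑ α, ∑ β, A α β • ((ContinuousLinearMap.proj (R := ℝ) (φ := fun _ : Fin m => ℝ) β).comp
      ((ContinuousLinearMap.snd ℝ _ _).comp (ContinuousLinearMap.snd ℝ _ _))).smulRight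
    ((ContinuousLinearMap.proj (R := ℝ) (φ := fun _ : Fin m => ℝ) α).comp
      ((ContinuousLinearMap.snd ℝ ℝ _).comp (ContinuousLinearMap.snd ℝ ℝ _)))

theorem matForm_apply (A : Matrix (Fin m) (Fin m) ℝ) (v w : J0 m) :
    matForm A v w = bil A w.2.2 v.2.2 := by
  simp only [matForm, bil, sum_apply, smul_apply,
    ContinuousLinearMap.smulRight_apply, ContinuousLinearMap.comp_apply, smul_eq_mul]
  refine Finset.sum_congr rfl fun α _ => Finset.sum_congr rfl fun β _ => ?_
  change A α β * (v.2.2 β * w.2.2 α) = _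
  ring

theorem contDiffOn_matForm {A : J0 m → Matrix (Fin m) (Fin m) ℝ} {V : Set (J0 m)}
    (hA : ∀ α β, ContDiffOn ℝ ∞ (fun y => A y α β) V) :
    ContDiffOn ℝ ∞ (fun y => matForm (A y)) V :=
  ContDiffOn.sum fun α _ => ContDiffOn.sum fun β _ => (hA α β).smul contDiffOn_const

/-! ### Functions and forms that descend to `J⁰` -/

/-- The inclusion `J⁰ → J¹` with vanishing derivatives. -/
def incJ0 : J0 m →L[ℝ] J1 m :=
  (ContinuousLinearMap.fst ℝ _ _).prod
    (((ContinuousLinearMap.fst ℝ _ _).comp (ContinuousLinearMap.snd ℝ _ _)).prod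
      (((ContinuousLinearMap.snd ℝ _ _).comp (ContinuousLinearMap.snd ℝ _ _)).prod 0))

theorem incJ0_apply (a : J0 m) : incJ0 a = ((a.1, a.2.1, a.2.2, 0, 0) : J1 m) := rfl

theorem isOpen_toJ0_image {U : Set (J1 m)} (hU : IsOpen U) : IsOpen (J1.toJ0 '' U) := by
  have hs : Function.Surjective (toJ0L : J1 m →L[ℝ] J0 m) := fun a => ⟨incJ0 a, rfl⟩
  exact toJ0L.isOpenMap hs U hU

theorem convex_toJ0_image {U : Set (J1 m)} (hU : Convex ℝ U) : Convex ℝ (J1.toJ0 '' U) :=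
  hU.linear_image (toJ0L : J1 m →L[ℝ] J0 m).toLinearMap

section descent

variable {F : Type*} [NormedAddCommGroup F] [NormedSpace ℝ F] {U : Set (J1 m)} {g : J1 m → F}

/-- Two points of U in the same fibre of J¹ → J⁰ are joined by a segment inside U, along which g has
zero derivative. -/
theorem eq_of_fderiv_vertical_eq_zero (hconv : Convex ℝ U)
    (hg : ∀ z ∈ U, DifferentiableAt ℝ g z)
    (hv : ∀ z ∈ U, ∀ e : J1 m, e.toJ0 = 0 → fderiv ℝ g z e = 0) {z z' : J1 m} (hz : z ∈ U)
    (hz' : z' ∈ U) (h : z.toJ0 = z'.toJ0) : g z = g z' := by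
  have hmem : ∀ t ∈ Set.Icc (0 : ℝ) 1, z + t • (z' - z) ∈ U := fun t ht =>
    hconv.add_smul_sub_mem hz hz' ht
  have hd : ∀ t ∈ Set.Icc (0 : ℝ) 1, HasDerivAt (fun t : ℝ => g (z + t • (z' - z))) 0 t := by
    intro t ht
    have h1 : HasDerivAt (fun t : ℝ => z + t • (z' - z)) (z' - z) t := by
      have h := ((hasDerivAt_id t).smul_const (z' - z)).const_add z
      rw [one_smul] at h
      exact h
    have h2 := (hg _ (hmem t ht)).hasFDerivAt.comp_hasDerivAt t h1
    rwa [hv _ (hmem t ht)] at h2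
    have : toJ0L (z' - z) = 0 := by rw [map_sub, toJ0L_apply, toJ0L_apply, h, sub_self]
    exact this
  have := constant_of_has_deriv_right_zero (f := fun t : ℝ => g (z + t • (z' - z)))
    (fun t ht => (hd t ht).continuousAt.continuousWithinAt)
    (fun t ht => (hd t (Set.Ico_subset_Icc_self ht)).hasDerivWithinAt) 1 ⟨zero_le_one, le_rfl⟩
  simpa using this.symm

theorem exists_descent (hU : IsOpen U) (hconv : Convex ℝ U) (hg : ContDiffOn ℝ ∞ g U)
    (hv : ∀ z ∈ U, ∀ e : J1 m, e.toJ0 = 0 → fderiv ℝ g z e = 0) :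
    ∃ G : J0 m → F, ContDiffOn ℝ ∞ G (J1.toJ0 '' U) ∧ (∀ z ∈ U, G z.toJ0 = g z) ∧
      ∀ z ∈ U, ∀ a : J0 m, fderiv ℝ G z.toJ0 a = fderiv ℝ g z (incJ0 a) := by
  classical
  have hga : ∀ z ∈ U, ContDiffAt ℝ ∞ g z := fun z hz => hg.contDiffAt (hU.mem_nhds hz)
  have hgd : ∀ z ∈ U, DifferentiableAt ℝ g z := fun z hz => (hga z hz).differentiableAt (by simp)
  -- The chosen point of the fibre is immaterial; the value 0 off the image is a dummy.
  let G : J0 m → F := fun y => if h : y ∈ J1.toJ0 '' U then g h.choose else 0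
  have hG : ∀ z ∈ U, G z.toJ0 = g z := by
    intro z hz
    have h : z.toJ0 ∈ J1.toJ0 '' U := ⟨z, hz, rfl⟩
    have : G z.toJ0 = g h.choose := dif_pos h
    rw [this]
    exact eq_of_fderiv_vertical_eq_zero hconv hgd hv h.choose_spec.1 hz h.choose_spec.2
  -- Near `z.toJ0`, G is g composed with the affine section of J¹ → J⁰ through z, which stays in U.
  -- Smoothness and derivative of G are read off from this.
  have hloc : ∀ z ∈ U, G =ᶠ[𝓝 z.toJ0] fun y => g (incJ0 y + (z - incJ0 z.toJ0)) := by
    intro z hz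
    have hc : Continuous fun y : J0 m => incJ0 y + (z - incJ0 z.toJ0) := by fun_prop
    have h : (fun y : J0 m => incJ0 y + (z - incJ0 z.toJ0)) ⁻¹' U ∈ 𝓝 z.toJ0 := by
      refine (hU.preimage hc).mem_nhds ?_
      simpa using hz
    filter_upwards [h] with y hy
    rw [← hG _ hy]
    congr 1
    have : toJ0L (incJ0 y + (z - incJ0 z.toJ0)) = y := by
      rw [map_add, map_sub]
      change y + (z.toJ0 - z.toJ0) = y
      simp
    exact this.symm
  have hbase : ∀ z : J1 m, incJ0 z.toJ0 + (z - incJ0 z.toJ0) = z := fun z => by simp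
  refine ⟨G, ?_, hG, ?_⟩
  · rintro _ ⟨z, hz, rfl⟩
    refine (ContDiffAt.congr_of_eventuallyEq ?_ (hloc z hz)).contDiffWithinAt
    refine ContDiffAt.comp (g := g) (f := fun y => incJ0 y + (z - incJ0 z.toJ0)) z.toJ0 ?_
      (incJ0.contDiff.add contDiff_const).contDiffAt
    rw [hbase]
    exact hga z hz
  · intro z hz a
    rw [(hloc z hz).fderiv_eq]
    have h1 : HasFDerivAt (fun y : J0 m => incJ0 y + (z - incJ0 z.toJ0)) incJ0 z.toJ0 :=
      incJ0.hasFDerivAt.add_const _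
    have h2 : HasFDerivAt g (fderiv ℝ g z) (incJ0 z.toJ0 + (z - incJ0 z.toJ0)) := by
      rw [hbase]
      exact (hgd z hz).hasFDerivAt
    have h3 : HasFDerivAt (fun y : J0 m => g (incJ0 y + (z - incJ0 z.toJ0)))
        ((fderiv ℝ g z).comp incJ0) z.toJ0 :=
      HasFDerivAt.comp (f := fun y : J0 m => incJ0 y + (z - incJ0 z.toJ0)) z.toJ0 h2 h1
    rw [h3.fderiv]
    rfl

end descent

/-- A trilinear function on a finite-dimensional space as a continuous trilinear map. -/
theorem exists_trilinear {E : Type*} [NormedAddCommGroup E] [NormedSpace ℝ E]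
    [FiniteDimensional ℝ E] (f : E → E → E → ℝ)
    (add₁ : ∀ a a' b c, f (a + a') b c = f a b c + f a' b c)
    (smul₁ : ∀ (r : ℝ) a b c, f (r • a) b c = r * f a b c)
    (h12 : ∀ a b c, f a b c = -f b a c) (h23 : ∀ a b c, f a b c = -f a c b) :
    ∃ g : E →L[ℝ] E →L[ℝ] E →L[ℝ] ℝ, ∀ a b c, g a b c = f a b c := by
  have add₂ : ∀ a b b' c, f a (b + b') c = f a b c + f a b' c := fun a b b' c => by
    rw [h12, add₁, h12 a b, h12 a b']; ring
  have smul₂ : ∀ (r : ℝ) a b c, f a (r • b) c = r * f a b c := fun r a b c => by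
    rw [h12, smul₁, h12 a b]; ring
  have add₃ : ∀ a b c c', f a b (c + c') = f a b c + f a b c' := fun a b c c' => by
    rw [h23, add₂, h23 a b c, h23 a b c']; ring
  have smul₃ : ∀ (r : ℝ) a b c, f a b (r • c) = r * f a b c := fun r a b c => by
    rw [h23, smul₂, h23 a b c]; ring
  let g₁ : E → E → E →L[ℝ] ℝ := fun a b => LinearMap.toContinuousLinearMap
    { toFun := f a b, map_add' := add₃ a b, map_smul' := fun r c => smul₃ r a b c }
  let g₂ : E → E →L[ℝ] E →L[ℝ] ℝ := fun a => LinearMap.toContinuousLinearMap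
    { toFun := g₁ a
      map_add' := fun b b' => ContinuousLinearMap.ext fun c => add₂ a b b' c
      map_smul' := fun r b => ContinuousLinearMap.ext fun c => smul₂ r a b c }
  let g₃ : E →L[ℝ] E →L[ℝ] E →L[ℝ] ℝ := LinearMap.toContinuousLinearMap
    { toFun := g₂
      map_add' := fun a a' => ContinuousLinearMap.ext fun b => ContinuousLinearMap.ext fun c =>
        add₁ a a' b c
      map_smul' := fun r a => ContinuousLinearMap.ext fun b => ContinuousLinearMap.ext fun c =>
        smul₁ r a b c }
  exact ⟨g₃, fun _ _ _ => rfl⟩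

/-! ### Restriction to the jets with vanishing higher pure derivatives -/

/-- The section of `R^∞ → J¹` with vanishing higher pure derivatives. -/
def lift (z : J1 m) : RInf m :=
  (z.x, z.y, z.u, fun n => Nat.casesOn n z.ux fun _ => 0, fun n => Nat.casesOn n z.uy fun _ => 0)

/-- The section is linear, so it carries lines to lines, and line derivatives on R^∞ along lifted
vectors are line derivatives on J¹. -/
theorem lift_add_smul (z a : J1 m) (t : ℝ) : lift (z + t • a) = lift z + t • lift a := by
  simp only [lift, Prod.smul_mk, Prod.mk_add_mk, Prod.mk.injEq]
  refine ⟨rfl, rfl, rfl, ?_, ?_⟩ <;>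
  · funext n
    cases n
    · rfl
    · simp

theorem continuous_lift : Continuous (lift : J1 m → RInf m) := by
  have hx : Continuous (J1.ux : J1 m → _) := uxL.continuous
  have hy : Continuous (J1.uy : J1 m → _) := uyL.continuous
  refine continuous_fst.prodMk ((continuous_fst.comp continuous_snd).prodMk
    ((continuous_fst.comp (continuous_snd.comp continuous_snd)).prodMk (Continuous.prodMk ?_ ?_)))
  · refine continuous_pi fun n => ?_
    cases n
    · exact hx
    · exact continuous_const
  · refine continuous_pi fun n => ?_
    cases n
    · exact hy
    · exact continuous_const

theorem contDiff_proj_lift (k : ℕ) : ContDiff ℝ ∞ fun z : J1 m => (lift z).proj k := by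
  have hx : ContDiff ℝ ∞ (J1.ux : J1 m → _) := uxL.contDiff
  have hy : ContDiff ℝ ∞ (J1.uy : J1 m → _) := uyL.contDiff
  refine contDiff_fst.prodMk ((contDiff_fst.comp contDiff_snd).prodMk
    ((contDiff_fst.comp (contDiff_snd.comp contDiff_snd)).prodMk (ContDiff.prodMk ?_ ?_)))
  · refine contDiff_pi.2 fun n => ?_
    rcases n with ⟨n, hn⟩
    cases n
    · exact hx
    · exact contDiff_const
  · refine contDiff_pi.2 fun n => ?_
    rcases n with ⟨n, hn⟩
    cases n
    · exact hy
    · exact contDiff_const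

theorem SmoothOn.contDiffOn_lift {g : RInf m → ℝ} {U : Set (J1 m)}
    (hg : SmoothOn g (RInf.toJ1 ⁻¹' U)) : ContDiffOn ℝ ∞ (fun z => g (lift z)) U := by
  intro z hz
  obtain ⟨k, G, hG, hgG⟩ := hg (lift z) hz
  have h1 : (fun z => g (lift z)) =ᶠ[𝓝 z] fun z => G ((lift z).proj k) :=
    continuous_lift.continuousAt.eventually hgG
  refine (ContDiffAt.congr_of_eventuallyEq ?_ h1).contDiffWithinAt
  exact ContDiffAt.comp (f := fun z : J1 m => (lift z).proj k) z hG
    (contDiff_proj_lift k).contDiffAt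

/-- The jet of second order over `z` with `u_xx = u_yy = 0`. -/
def jet0 (f : J1 m → Fin m → ℝ) (z : J1 m) : Fibre2 m := ⟨0, f z, 0⟩

/-- The restriction of `omega` to `J¹`, with coefficients given on `J¹`. -/
def omegaJ1 (f : J1 m → Fin m → ℝ) (T S R : J1 m → Matrix (Fin m) (Fin m) ℝ) (z a b c : J1 m) :
    ℝ :=
  tri (T z) (S z) (R z) (coframe z (jet0 f z) a) (coframe z (jet0 f z) b) (coframe z (jet0 f z) c)

theorem lineDeriv_omega_lift (f : J1 m → Fin m → ℝ) (T S R : RInf m → Matrix (Fin m) (Fin m) ℝ)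
    (z a b c e : J1 m) :
    lineDeriv ℝ (fun q => omega f T S R q ![lift a, lift b, lift c]) (lift z) (lift e)
      = lineDeriv ℝ (fun y => omegaJ1 f (fun z => T (lift z)) (fun z => S (lift z))
          (fun z => R (lift z)) y a b c) z e := by
  unfold lineDeriv
  congr 1
  funext t
  rw [← lift_add_smul]
  exact omega_apply f T S R _ _

section smoothness

variable {E : Type*} [NormedAddCommGroup E] [NormedSpace ℝ E] {z : E}

theorem contDiffAt_bil {A : E → Matrix (Fin m) (Fin m) ℝ} {a b : E → Fin m → ℝ}
    (hA : ∀ α β, ContDiffAt ℝ ∞ (fun y => A y α β) z) (ha : ContDiffAt ℝ ∞ a z)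
    (hb : ContDiffAt ℝ ∞ b z) : ContDiffAt ℝ ∞ (fun y => bil (A y) (a y) (b y)) z :=
  ContDiffAt.sum fun α _ => ContDiffAt.sum fun β _ =>
    ((hA α β).mul (contDiffAt_pi.1 ha α)).mul (contDiffAt_pi.1 hb β)

theorem contDiffAt_tri {T S R : E → Matrix (Fin m) (Fin m) ℝ} {a b c : E → J1 m}
    (hT : ∀ α β, ContDiffAt ℝ ∞ (fun y => T y α β) z)
    (hS : ∀ α β, ContDiffAt ℝ ∞ (fun y => S y α β) z)
    (hR : ∀ α β, ContDiffAt ℝ ∞ (fun y => R y α β) z)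
    (ha : ContDiffAt ℝ ∞ a z) (hb : ContDiffAt ℝ ∞ b z) (hc : ContDiffAt ℝ ∞ c z) :
    ContDiffAt ℝ ∞ (fun y => tri (T y) (S y) (R y) (a y) (b y) (c y)) z := by
  have hx : ∀ {v : E → J1 m}, ContDiffAt ℝ ∞ v z → ContDiffAt ℝ ∞ (fun y => (v y).x) z :=
    fun h => h.fst
  have hy : ∀ {v : E → J1 m}, ContDiffAt ℝ ∞ v z → ContDiffAt ℝ ∞ (fun y => (v y).y) z :=
    fun h => h.snd.fst
  have hu : ∀ {v : E → J1 m}, ContDiffAt ℝ ∞ v z → ContDiffAt ℝ ∞ (fun y => (v y).u) z :=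
    fun h => h.snd.snd.fst
  have hux : ∀ {v : E → J1 m}, ContDiffAt ℝ ∞ v z → ContDiffAt ℝ ∞ (fun y => (v y).ux) z :=
    fun h => h.snd.snd.snd.fst
  have huy : ∀ {v : E → J1 m}, ContDiffAt ℝ ∞ v z → ContDiffAt ℝ ∞ (fun y => (v y).uy) z :=
    fun h => h.snd.snd.snd.snd
  have hT' : ∀ {v w : E → J1 m}, ContDiffAt ℝ ∞ v z → ContDiffAt ℝ ∞ w z →
      ContDiffAt ℝ ∞ (fun y => bil (T y) (v y).u (w y).u) z :=
    fun hv hw => contDiffAt_bil hT (hu hv) (hu hw)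
  have hS' : ∀ {v w : E → J1 m}, ContDiffAt ℝ ∞ v z → ContDiffAt ℝ ∞ w z →
      ContDiffAt ℝ ∞ (fun y => bil (S y) (v y).u (w y).u) z :=
    fun hv hw => contDiffAt_bil hS (hu hv) (hu hw)
  have hRx : ∀ {v w : E → J1 m}, ContDiffAt ℝ ∞ v z → ContDiffAt ℝ ∞ w z →
      ContDiffAt ℝ ∞ (fun y => bil (R y) (v y).u (w y).ux) z :=
    fun hv hw => contDiffAt_bil hR (hu hv) (hux hw)
  have hRy : ∀ {v w : E → J1 m}, ContDiffAt ℝ ∞ v z → ContDiffAt ℝ ∞ w z →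
      ContDiffAt ℝ ∞ (fun y => bil (R y) (v y).uy (w y).u) z :=
    fun hv hw => contDiffAt_bil hR (huy hv) (hu hw)
  unfold tri
  exact ((((((hx ha).mul ((hT' hb hc).sub (hT' hc hb))).add
    ((hx hb).mul ((hT' hc ha).sub (hT' ha hc)))).add
    ((hx hc).mul ((hT' ha hb).sub (hT' hb ha)))).add
    ((((hy ha).mul ((hS' hb hc).sub (hS' hc hb))).add
    ((hy hb).mul ((hS' hc ha).sub (hS' ha hc)))).add
    ((hy hc).mul ((hS' ha hb).sub (hS' hb ha))))).add
    ((((hx ha).mul ((hRx hb hc).sub (hRx hc hb))).add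
    ((hx hb).mul ((hRx hc ha).sub (hRx ha hc)))).add
    ((hx hc).mul ((hRx ha hb).sub (hRx hb ha))))).sub
    ((((hy ha).mul ((hRy hc hb).sub (hRy hb hc))).add
    ((hy hb).mul ((hRy ha hc).sub (hRy hc ha)))).add
    ((hy hc).mul ((hRy hb ha).sub (hRy ha hb))))

end smoothness

theorem contDiffAt_coframe {f : J1 m → Fin m → ℝ} {z : J1 m} (hf : ContDiffAt ℝ ∞ f z)
    (v : J1 m) : ContDiffAt ℝ ∞ (fun y => coframe y (jet0 f y) v) z := by
  have hx : ContDiffAt ℝ ∞ (J1.ux : J1 m → _) z := uxL.contDiff.contDiffAt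
  have hy : ContDiffAt ℝ ∞ (J1.uy : J1 m → _) z := uyL.contDiff.contDiffAt
  simp only [coframe, jet0]
  exact contDiffAt_const.prodMk (contDiffAt_const.prodMk
    (((contDiffAt_const.sub (hx.const_smul v.x)).sub (hy.const_smul v.y)).prodMk
      (((contDiffAt_const.sub contDiffAt_const).sub (hf.const_smul v.y)).prodMk
        ((contDiffAt_const.sub (hf.const_smul v.x)).sub contDiffAt_const))))

/-! ### Closedness of the restricted form and its consequence for R. -/

section closed

variable {f : J1 m → Fin m → ℝ} {T S R : J1 m → Matrix (Fin m) (Fin m) ℝ} {U : Set (J1 m)}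

theorem contDiffAt_omegaJ1 (hU : IsOpen U) (hf : ContDiffOn ℝ ∞ f U)
    (hT : ∀ α β, ContDiffOn ℝ ∞ (fun z => T z α β) U)
    (hS : ∀ α β, ContDiffOn ℝ ∞ (fun z => S z α β) U)
    (hR : ∀ α β, ContDiffOn ℝ ∞ (fun z => R z α β) U) {z : J1 m} (hz : z ∈ U) (a b c : J1 m) :
    ContDiffAt ℝ ∞ (fun y => omegaJ1 f T S R y a b c) z := by
  have hz' := hU.mem_nhds hz
  have hfz := hf.contDiffAt hz'
  exact contDiffAt_tri (fun α β => (hT α β).contDiffAt hz') (fun α β => (hS α β).contDiffAt hz')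
    (fun α β => (hR α β).contDiffAt hz') (contDiffAt_coframe hfz a) (contDiffAt_coframe hfz b)
    (contDiffAt_coframe hfz c)

/-- A `3`-form on `J¹`, given by its values on constant vector fields, is closed on `U`. -/
def ClosedOn (s : J1 m → J1 m → J1 m → J1 m → ℝ) (U : Set (J1 m)) : Prop :=
  ∀ z ∈ U, ∀ a b c d, fderiv ℝ (fun y => s y b c d) z a - fderiv ℝ (fun y => s y a c d) z b
    + fderiv ℝ (fun y => s y a b d) z c - fderiv ℝ (fun y => s y a b c) z d = 0

/-- Pullback along the linear section commutes with d: the hypothesis is used only at lifted points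
and lifted vectors. -/
theorem closedOn_omegaJ1 {T S R : RInf m → Matrix (Fin m) (Fin m) ℝ}
    (hd : ∀ z ∈ U, ∀ a b c, DifferentiableAt ℝ (fun y => omegaJ1 f (fun z => T (lift z))
      (fun z => S (lift z)) (fun z => R (lift z)) y a b c) z)
    (h : ∀ p ∈ RInf.toJ1 ⁻¹' U, ∀ v, extD (omega f T S R) p v = 0) :
    ClosedOn (omegaJ1 f (fun z => T (lift z)) (fun z => S (lift z)) (fun z => R (lift z))) U := by
  intro z hz a b c d
  have h1 := h (lift z) hz ![lift a, lift b, lift c, lift d]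
  rw [extD_apply_four] at h1
  have h2 : ∀ a b c e, lineDeriv ℝ (fun q => omega f T S R q ![lift a, lift b, lift c]) (lift z)
      (lift e) = fderiv ℝ (fun y => omegaJ1 f (fun z => T (lift z)) (fun z => S (lift z))
        (fun z => R (lift z)) y a b c) z e := fun a b c e => by
    rw [lineDeriv_omega_lift, (hd z hz a b c).lineDeriv_eq_fderiv]
  rw [← h2, ← h2, ← h2, ← h2]
  exact h1

/-- In dω(∂_{u_y}, ∂_{u^α}, ∂_{u_x^β}, ∂_x) only the derivative of ω(∂_{u^α}, ∂_{u_x^β}, ∂_x) =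
R_{αβ} survives, as ω has no θ_y∧dx term; so ∂R/∂u_y = 0. The dy-part of ω gives ∂R/∂u_x = 0 in the
same way. -/
theorem fderiv_R_vertical_eq_zero (hcl : ClosedOn (omegaJ1 f T S R) U)
    {z : J1 m} (hz : z ∈ U) (α β : Fin m) (e : J1 m) (he : e.toJ0 = 0) :
    fderiv ℝ (fun y => R y α β) z e = 0 := by
  have hx : ∀ s, fderiv ℝ (fun y => R y α β) z (vecUy s) = 0 := by
    intro s
    have h := hcl z hz (vecUy s) (vecU (Pi.single α 1)) (vecUx (Pi.single β 1)) (1, 0, 0, 0, 0)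
    have e1 : ∀ y, omegaJ1 f T S R y (vecU (Pi.single α 1)) (vecUx (Pi.single β 1))
        (1, 0, 0, 0, 0) = R y α β := fun y => by
      simp [omegaJ1, tri, coframe, vecU, vecUx, J1.x, J1.y, J1.u, J1.ux, J1.uy, bil_zero_left,
        bil_zero_right, bil_single]
    have e2 : ∀ y, omegaJ1 f T S R y (vecUy s) (vecUx (Pi.single β 1))
        (1, 0, 0, 0, 0) = 0 := fun y => by
      simp [omegaJ1, tri, coframe, vecUy, vecUx, J1.x, J1.y, J1.u, J1.ux, J1.uy, bil_zero_left,
        bil_zero_right]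
    have e3 : ∀ y, omegaJ1 f T S R y (vecUy s) (vecU (Pi.single α 1))
        (1, 0, 0, 0, 0) = 0 := fun y => by
      simp [omegaJ1, tri, coframe, vecUy, vecU, J1.x, J1.y, J1.u, J1.ux, J1.uy, bil_zero_left,
        bil_zero_right]
    have e4 : ∀ y, omegaJ1 f T S R y (vecUy s) (vecU (Pi.single α 1))
        (vecUx (Pi.single β 1)) = 0 := fun y => by
      simp [omegaJ1, tri, coframe, vecUy, vecU, vecUx, J1.x, J1.y, J1.u, J1.ux, J1.uy]
    simpa [e1, e2, e3, e4] using h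
  have hy : ∀ s, fderiv ℝ (fun y => R y α β) z (vecUx s) = 0 := by
    intro s
    have h := hcl z hz (vecUx s) (vecU (Pi.single β 1)) (vecUy (Pi.single α 1)) (0, 1, 0, 0, 0)
    have e1 : ∀ y, omegaJ1 f T S R y (vecU (Pi.single β 1)) (vecUy (Pi.single α 1))
        (0, 1, 0, 0, 0) = -R y α β := fun y => by
      simp [omegaJ1, tri, coframe, vecU, vecUy, J1.x, J1.y, J1.u, J1.ux, J1.uy, bil_zero_left,
        bil_zero_right, bil_single]
    have e2 : ∀ y, omegaJ1 f T S R y (vecUx s) (vecUy (Pi.single α 1))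
        (0, 1, 0, 0, 0) = 0 := fun y => by
      simp [omegaJ1, tri, coframe, vecUy, vecUx, J1.x, J1.y, J1.u, J1.ux, J1.uy, bil_zero_left,
        bil_zero_right]
    have e3 : ∀ y, omegaJ1 f T S R y (vecUx s) (vecU (Pi.single β 1))
        (0, 1, 0, 0, 0) = 0 := fun y => by
      simp [omegaJ1, tri, coframe, vecUx, vecU, J1.x, J1.y, J1.u, J1.ux, J1.uy, bil_zero_left,
        bil_zero_right]
    have e4 : ∀ y, omegaJ1 f T S R y (vecUx s) (vecU (Pi.single β 1))
        (vecUy (Pi.single α 1)) = 0 := fun y => by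
      simp [omegaJ1, tri, coframe, vecUy, vecU, vecUx, J1.x, J1.y, J1.u, J1.ux, J1.uy]
    simpa [e1, e2, e3, e4] using h
  have hdec : e = vecUx e.ux + vecUy e.uy := by
    obtain ⟨x, y, u, ux, uy⟩ := e
    have h1 : x = 0 := congrArg Prod.fst he
    have h2 : y = 0 := congrArg (fun a => a.2.1) he
    have h3 : u = 0 := congrArg (fun a => a.2.2) he
    simp [vecUx, vecUy, J1.ux, J1.uy, h1, h2, h3]
  rw [hdec, map_add, hx, hy, add_zero]

end closed

/-! ### The part of the form that descends to `J⁰` -/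

theorem bil_add_left (A : Matrix (Fin m) (Fin m) ℝ) (a a' b : Fin m → ℝ) :
    bil A (a + a') b = bil A a b + bil A a' b := by
  simp [bil, mul_add, add_mul, Finset.sum_add_distrib]

theorem bil_add_right (A : Matrix (Fin m) (Fin m) ℝ) (a b b' : Fin m → ℝ) :
    bil A a (b + b') = bil A a b + bil A a b' := by
  simp [bil, mul_add, Finset.sum_add_distrib]

theorem bil_smul_left (A : Matrix (Fin m) (Fin m) ℝ) (r : ℝ) (a b : Fin m → ℝ) :
    bil A (r • a) b = r * bil A a b := by
  simp only [bil, Finset.mul_sum, Pi.smul_apply, smul_eq_mul]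
  refine Finset.sum_congr rfl fun α _ => Finset.sum_congr rfl fun β _ => ?_
  ring

theorem bil_smul_right (A : Matrix (Fin m) (Fin m) ℝ) (r : ℝ) (a b : Fin m → ℝ) :
    bil A a (r • b) = r * bil A a b := by
  simp only [bil, Finset.mul_sum, Pi.smul_apply, smul_eq_mul]
  refine Finset.sum_congr rfl fun α _ => Finset.sum_congr rfl fun β _ => ?_
  ring

theorem bil_zero_matrix (a b : Fin m → ℝ) : bil 0 a b = 0 := by
  simp [bil]

/-- The value of `(T_{αβ} dx + S_{αβ} dy) ∧ θ^α ∧ θ^β - E_α θ^α ∧ dx ∧ dy` on three vectors with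
components `(dx, dy, θ, θ_x, θ_y)`. -/
def basicForm (T S : Matrix (Fin m) (Fin m) ℝ) (E : (Fin m → ℝ) → ℝ) (a b c : J1 m) : ℝ :=
  tri T S 0 a b c - (E a.u * (b.x * c.y - b.y * c.x) + E b.u * (c.x * a.y - c.y * a.x)
    + E c.u * (a.x * b.y - a.y * b.x))

theorem basicForm_swap_left (T S : Matrix (Fin m) (Fin m) ℝ) (E : (Fin m → ℝ) → ℝ)
    (a b c : J1 m) : basicForm T S E a b c = -basicForm T S E b a c := by
  simp only [basicForm, tri, bil_zero_matrix]
  ring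

theorem basicForm_swap_right (T S : Matrix (Fin m) (Fin m) ℝ) (E : (Fin m → ℝ) → ℝ)
    (a b c : J1 m) : basicForm T S E a b c = -basicForm T S E a c b := by
  simp only [basicForm, tri, bil_zero_matrix]
  ring

theorem basicForm_add (T S : Matrix (Fin m) (Fin m) ℝ) {E : (Fin m → ℝ) → ℝ}
    (hE : ∀ a b, E (a + b) = E a + E b) (a a' b c : J1 m) :
    basicForm T S E (a + a') b c = basicForm T S E a b c + basicForm T S E a' b c := by
  have hx : (a + a').x = a.x + a'.x := rfl
  have hy : (a + a').y = a.y + a'.y := rfl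
  have hu : (a + a').u = a.u + a'.u := rfl
  simp only [basicForm, tri, bil_zero_matrix, hx, hy, hu, hE, bil_add_left, bil_add_right]
  ring

theorem basicForm_smul (T S : Matrix (Fin m) (Fin m) ℝ) {E : (Fin m → ℝ) → ℝ}
    (hE : ∀ (r : ℝ) a, E (r • a) = r * E a) (r : ℝ) (a b c : J1 m) :
    basicForm T S E (r • a) b c = r * basicForm T S E a b c := by
  have hx : (r • a).x = r * a.x := rfl
  have hy : (r • a).y = r * a.y := rfl
  have hu : (r • a).u = r • a.u := rfl
  simp only [basicForm, tri, bil_zero_matrix, hx, hy, hu, hE, bil_smul_left, bil_smul_right]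
  ring

theorem basicForm_of_vertical (T S : Matrix (Fin m) (Fin m) ℝ) {E : (Fin m → ℝ) → ℝ}
    (hE : E 0 = 0) {a : J1 m} (ha : a.toJ0 = 0) (b c : J1 m) : basicForm T S E a b c = 0 := by
  have h1 : a.x = 0 := congrArg Prod.fst ha
  have h2 : a.y = 0 := congrArg (fun a => a.2.1) ha
  have h3 : a.u = 0 := congrArg (fun a => a.2.2) ha
  simp [basicForm, tri, bil_zero_matrix, h1, h2, h3, hE, bil_zero_left, bil_zero_right]

theorem coframe_add (z : J1 m) (w : Fibre2 m) (a b : J1 m) :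
    coframe z w (a + b) = coframe z w a + coframe z w b := by
  have hx : (a + b).x = a.x + b.x := rfl
  have hy : (a + b).y = a.y + b.y := rfl
  have hu : (a + b).u = a.u + b.u := rfl
  have hux : (a + b).ux = a.ux + b.ux := rfl
  have huy : (a + b).uy = a.uy + b.uy := rfl
  simp only [coframe, hx, hy, hu, hux, huy, Prod.mk_add_mk, Prod.mk.injEq]
  refine ⟨trivial, trivial, ?_, ?_, ?_⟩ <;> module

theorem coframe_smul (z : J1 m) (w : Fibre2 m) (r : ℝ) (a : J1 m) :
    coframe z w (r • a) = r • coframe z w a := by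
  have hx : (r • a).x = r * a.x := rfl
  have hy : (r • a).y = r * a.y := rfl
  have hu : (r • a).u = r • a.u := rfl
  have hux : (r • a).ux = r • a.ux := rfl
  have huy : (r • a).uy = r • a.uy := rfl
  simp only [coframe, hx, hy, hu, hux, huy, Prod.smul_mk, Prod.mk.injEq]
  refine ⟨rfl, rfl, ?_, ?_, ?_⟩ <;> module

theorem coframe_toJ0_eq_zero (z : J1 m) (w : Fibre2 m) {a : J1 m} (ha : a.toJ0 = 0) :
    (coframe z w a).toJ0 = 0 := by
  have h1 : a.x = 0 := congrArg Prod.fst ha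
  have h2 : a.y = 0 := congrArg (fun a => a.2.1) ha
  have h3 : a.u = 0 := congrArg (fun a => a.2.2) ha
  change (a.x, a.y, a.u - a.x • z.ux - a.y • z.uy) = (0 : J0 m)
  rw [h1, h2, h3]
  simp

theorem el_add (L : J1 m → ℝ) (z : J1 m) (w : Fibre2 m) (a b : Fin m → ℝ) :
    el L z w (a + b) = el L z w a + el L z w b := by
  simp only [el, map_add]
  ring

theorem el_smul (L : J1 m → ℝ) (z : J1 m) (w : Fibre2 m) (r : ℝ) (a : Fin m → ℝ) :
    el L z w (r • a) = r * el L z w a := by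
  simp only [el, map_smul, smul_eq_mul]
  ring

theorem el_zero (L : J1 m → ℝ) (z : J1 m) (w : Fibre2 m) : el L z w 0 = 0 := by
  simp [el]

theorem tri_sub_tri (T S R T' S' : Matrix (Fin m) (Fin m) ℝ) (a b c : J1 m) :
    tri T S R a b c - tri T' S' R a b c = tri (T - T') (S - S') 0 a b c := by
  simp only [tri, bil_sub_matrix, bil_zero_matrix]
  ring

/-- A closed alternating `3`-form on a convex open `U ⊆ J¹` that kills the vertical vectors of
`J¹ → J⁰` has a primitive on the image of `U` in `J⁰`. -/
theorem exists_primitive_on_J0 {U : Set (J1 m)} (hU : IsOpen U) (hconv : Convex ℝ U)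
    {s : J1 m → J1 m → J1 m → J1 m → ℝ} (hs : ∀ z ∈ U, ∀ a b c, ContDiffAt ℝ ∞ (fun y => s y a b c) z)
    (hcl : ClosedOn s U)
    (hadd : ∀ z ∈ U, ∀ a a' b c, s z (a + a') b c = s z a b c + s z a' b c)
    (hsmul : ∀ z ∈ U, ∀ (r : ℝ) a b c, s z (r • a) b c = r * s z a b c)
    (h12 : ∀ z ∈ U, ∀ a b c, s z a b c = -s z b a c)
    (h23 : ∀ z ∈ U, ∀ a b c, s z a b c = -s z a c b)
    (hv : ∀ z ∈ U, ∀ e : J1 m, e.toJ0 = 0 → ∀ b c, s z e b c = 0) :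
    ∃ β : J0 m → J0 m →L[ℝ] J0 m →L[ℝ] ℝ, ContDiffOn ℝ ∞ β (J1.toJ0 '' U) ∧
      (∀ z ∈ U, ∀ a b, β z.toJ0 a b = -β z.toJ0 b a) ∧
      ∀ z ∈ U, ∀ a b c, fderiv ℝ β z.toJ0 a b c - fderiv ℝ β z.toJ0 b a c
        + fderiv ℝ β z.toJ0 c a b = s z (incJ0 a) (incJ0 b) (incJ0 c) := by
  classical
  have hex : ∀ z, ∃ g : J0 m →L[ℝ] J0 m →L[ℝ] J0 m →L[ℝ] ℝ, z ∈ U →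
      ∀ a b c, g a b c = s z (incJ0 a) (incJ0 b) (incJ0 c) := by
    intro z
    by_cases hz : z ∈ U
    · obtain ⟨g, hg⟩ := exists_trilinear (fun a b c : J0 m => s z (incJ0 a) (incJ0 b) (incJ0 c))
        (fun a a' b c => by rw [map_add, hadd z hz]) (fun r a b c => by rw [map_smul, hsmul z hz])
        (fun a b c => h12 z hz _ _ _) (fun a b c => h23 z hz _ _ _)
      exact ⟨g, fun _ => hg⟩
    · exact ⟨0, fun h => absurd h hz⟩
  choose g hg using hex
  have hgs : ContDiffOn ℝ ∞ g U := by
    rw [contDiffOn_clm_apply]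
    intro a
    rw [contDiffOn_clm_apply]
    intro b
    rw [contDiffOn_clm_apply]
    intro c
    exact ContDiffOn.congr (fun z hz => (hs z hz _ _ _).contDiffWithinAt)
      fun z hz => hg z hz a b c
  have hgd : ∀ z ∈ U, ∀ e a b c, fderiv ℝ g z e a b c
      = fderiv ℝ (fun y => s y (incJ0 a) (incJ0 b) (incJ0 c)) z e := by
    intro z hz e a b c
    have h0 : HasFDerivAt g (fderiv ℝ g z) z :=
      ((hgs.contDiffAt (hU.mem_nhds hz)).differentiableAt (by simp)).hasFDerivAt
    have h1 := ((h0.clm_apply (hasFDerivAt_const a z)).clm_apply (hasFDerivAt_const b z)).clm_apply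
      (hasFDerivAt_const c z)
    have h2 : (fun y => s y (incJ0 a) (incJ0 b) (incJ0 c)) =ᶠ[𝓝 z] fun y => g y a b c := by
      filter_upwards [hU.mem_nhds hz] with y hy
      exact (hg y hy a b c).symm
    rw [h2.fderiv_eq, h1.fderiv]
    simp
  -- In ds(e, a, b, c) with e vertical, the three terms with e as an argument of s vanish, so
  -- closedness says that the derivative of s along e is zero.
  have hgv : ∀ z ∈ U, ∀ e : J1 m, e.toJ0 = 0 → fderiv ℝ g z e = 0 := by
    intro z hz e he
    refine ContinuousLinearMap.ext fun a => ContinuousLinearMap.ext fun b =>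
      ContinuousLinearMap.ext fun c => ?_
    rw [hgd z hz]
    have h0 : ∀ b c, (fun y => s y e b c) =ᶠ[𝓝 z] fun _ => 0 := by
      intro b c
      filter_upwards [hU.mem_nhds hz] with y hy
      exact hv y hy e he b c
    have h1 := hcl z hz e (incJ0 a) (incJ0 b) (incJ0 c)
    rw [(h0 _ _).fderiv_eq, (h0 _ _).fderiv_eq, (h0 _ _).fderiv_eq] at h1
    simpa using h1
  obtain ⟨σ, hσ, hσg, hσd⟩ := exists_descent hU hconv hgs hgv
  obtain ⟨β, hβ, hβa, hβd⟩ := exists_primitive_of_closed_threeForm (isOpen_toJ0_image hU)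
    (convex_toJ0_image hconv) hσ
    (by
      rintro _ ⟨z, hz, rfl⟩ a b c
      rw [hσg z hz, hg z hz, hg z hz, h12 z hz])
    (by
      rintro _ ⟨z, hz, rfl⟩ a b c
      rw [hσg z hz, hg z hz, hg z hz, h23 z hz])
    (by
      rintro _ ⟨z, hz, rfl⟩ a b c d
      rw [hσd z hz, hσd z hz, hσd z hz, hσd z hz, hgd z hz, hgd z hz, hgd z hz, hgd z hz]
      exact hcl z hz _ _ _ _)
  refine ⟨β, hβ, fun z hz => hβa _ ⟨z, hz, rfl⟩, fun z hz a b c => ?_⟩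
  rw [hβd _ ⟨z, hz, rfl⟩, hσg z hz, hg z hz]

/-! ### From a closed form to a quadratic Lagrangian -/

theorem linearMap_eq_sum (φ : (Fin m → ℝ) →ₗ[ℝ] ℝ) (a : Fin m → ℝ) :
    φ a = ∑ α, φ (Pi.single α 1) * a α := by
  conv_lhs => rw [pi_eq_sum_univ' a]
  simp [mul_comm]

/-- Bilinear expansion of γ(∂_x + u_x ∂_u, ∂_y + u_y ∂_u): every bilinear form on J⁰ gives a
Lagrangian of the required quadratic shape. -/
theorem quadLagrangian_eq_bilLag (γ : J0 m → J0 m →L[ℝ] J0 m →L[ℝ] ℝ) :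
    quadLagrangian (fun y α β => -γ y (vecU0 (Pi.single α 1)) (vecU0 (Pi.single β 1)))
      (fun y α => γ y (vecU0 (Pi.single α 1)) (0, 1, 0))
      (fun y α => γ y (1, 0, 0) (vecU0 (Pi.single α 1)))
      (fun y => γ y (1, 0, 0) (0, 1, 0)) = bilLag γ := by
  funext z
  have hX : tot0X z = (1, 0, 0) + vecU0 z.ux := by simp [tot0X, vecU0_apply]
  have hY : tot0Y z = (0, 1, 0) + vecU0 z.uy := by simp [tot0Y, vecU0_apply]
  have h1 := linearMap_eq_sum ((γ z.toJ0 (1, 0, 0)).comp vecU0).toLinearMap z.uy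
  have h2 := linearMap_eq_sum (((γ z.toJ0).flip (0, 1, 0)).comp vecU0).toLinearMap z.ux
  have h3 := bil_eq_of_linear
    (fun α β => γ z.toJ0 (vecU0 (Pi.single α 1)) (vecU0 (Pi.single β 1)))
    (LinearMap.mk₂ ℝ (fun a b => γ z.toJ0 (vecU0 a) (vecU0 b)) (by simp) (by simp) (by simp)
      (by simp)) (fun _ _ => rfl) z.ux z.uy
  simp only [bil, LinearMap.mk₂_apply] at h3
  simp only [ContinuousLinearMap.coe_coe, ContinuousLinearMap.comp_apply,
    ContinuousLinearMap.flip_apply] at h1 h2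
  simp only [quadLagrangian, bilLag, hX, hY, map_add, add_apply, h1, h2, ← h3, neg_mul,
    Finset.sum_neg_distrib]
  ring

/-- The Lagrangian is `bilLag γ` with γ = γ₀ + β: γ₀ is built from R and reproduces the θ_x and θ_y
terms of ω, while the alternating β accounts for the rest. -/
theorem HasClosedForm.hasZerothOrderMultiplier {f : J1 m → Fin m → ℝ} {U : Set (J1 m)}
    (hU : IsOpen U) (hconv : Convex ℝ U) (hf : ContDiffOn ℝ ∞ f U) (h : HasClosedForm f U) :
    HasZerothOrderMultiplier f U := by
  obtain ⟨T', S', R', hT', hS', hR', hdet', hcl'⟩ := h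
  obtain ⟨T, hTdef⟩ : ∃ T : J1 m → Matrix (Fin m) (Fin m) ℝ, T = fun z => T' (lift z) := ⟨_, rfl⟩
  obtain ⟨S, hSdef⟩ : ∃ S : J1 m → Matrix (Fin m) (Fin m) ℝ, S = fun z => S' (lift z) := ⟨_, rfl⟩
  obtain ⟨R, hRdef⟩ : ∃ R : J1 m → Matrix (Fin m) (Fin m) ℝ, R = fun z => R' (lift z) := ⟨_, rfl⟩
  have hT : ∀ α β, ContDiffOn ℝ ∞ (fun z => T z α β) U := fun α β => by
    subst hTdef; exact (hT' α β).contDiffOn_lift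
  have hS : ∀ α β, ContDiffOn ℝ ∞ (fun z => S z α β) U := fun α β => by
    subst hSdef; exact (hS' α β).contDiffOn_lift
  have hR : ∀ α β, ContDiffOn ℝ ∞ (fun z => R z α β) U := fun α β => by
    subst hRdef; exact (hR' α β).contDiffOn_lift
  have hdet : ∀ z ∈ U, (R z + (R z).transpose).det ≠ 0 := fun z hz => by
    subst hRdef; exact hdet' (lift z) hz
  have hωs : ∀ z ∈ U, ∀ a b c, ContDiffAt ℝ ∞ (fun y => omegaJ1 f T S R y a b c) z :=
    fun z hz => contDiffAt_omegaJ1 hU hf hT hS hR hz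
  have hωcl : ClosedOn (omegaJ1 f T S R) U := by
    subst hTdef hSdef hRdef
    exact closedOn_omegaJ1 (fun z hz a b c => (hωs z hz a b c).differentiableAt (by simp)) hcl'
  have hdesc := fun α β => exists_descent hU hconv (hR α β)
    fun z hz e he => fderiv_R_vertical_eq_zero hωcl hz α β e he
  choose R₀ hR₀s hR₀ _ using hdesc
  let γ₀ : J0 m → J0 m →L[ℝ] J0 m →L[ℝ] ℝ := fun y => matForm fun α β => R₀ α β y
  have hγ₀s : ContDiffOn ℝ ∞ γ₀ (J1.toJ0 '' U) := contDiffOn_matForm hR₀s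
  have hV := isOpen_toJ0_image hU
  have hVz : ∀ z ∈ U, z.toJ0 ∈ J1.toJ0 '' U := fun z hz => ⟨z, hz, rfl⟩
  have hev : ∀ {γ : J0 m → J0 m →L[ℝ] J0 m →L[ℝ] ℝ}, ContDiffOn ℝ ∞ γ (J1.toJ0 '' U) →
      ∀ z ∈ U, ∀ᶠ y in 𝓝 z.toJ0, ContDiffAt ℝ ∞ γ y := fun hγ z hz =>
    Filter.mem_of_superset (hV.mem_nhds (hVz z hz)) fun y hy => hγ.contDiffAt (hV.mem_nhds hy)
  have hγ₀ : ∀ z ∈ U, ∀ a b, γ₀ z.toJ0 (vecU0 a) (vecU0 b) = bil (R z) b a := by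
    intro z hz a b
    have : (fun α β => R₀ α β z.toJ0) = R z := by
      ext α β
      exact hR₀ α β z hz
    simp only [γ₀, this, matForm_apply, vecU0_apply]
  have hL₀ : ∀ z ∈ U, ∀ᶠ y in 𝓝 z, ContDiffAt ℝ ∞ (bilLag γ₀) y := fun z hz =>
    (eventually_toJ0 (hev hγ₀s z hz)).mono fun y hy => contDiffAt_bilLag hy
  -- With equal R, the θ_x and θ_y terms of ω and dΘ cancel in the difference σ below, which
  -- therefore kills vertical vectors.
  have hlagR : ∀ z ∈ U, lagR (bilLag γ₀) z = R z := by
    intro z hz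
    ext α β
    have e0 : (vecUx (Pi.single β 1) : J1 m).toJ0 = 0 := rfl
    have e1 : (vecUx (Pi.single β 1) : J1 m).ux = Pi.single β 1 := rfl
    rw [lagR, fderiv_fderiv_bilLag_vecUy (hev hγ₀s z hz), e0, e1, hγ₀ z hz, bil_single]
    simp
  let σ : J1 m → J1 m → J1 m → J1 m → ℝ := fun z a b c =>
    omegaJ1 f T S R z a b c - dCartan (bilLag γ₀) z a b c
  have hσ : ∀ z ∈ U, ∀ a b c, σ z a b c = basicForm (T z - lagT (bilLag γ₀) z)
      (S z - lagS (bilLag γ₀) z) (el (bilLag γ₀) z (jet0 f z)) (coframe z (jet0 f z) a)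
      (coframe z (jet0 f z) b) (coframe z (jet0 f z) c) := by
    intro z hz a b c
    have hxx : ∀ a b, fderiv ℝ (fderiv ℝ (bilLag γ₀)) z (vecUx a) (vecUx b) = 0 := by
      intro a b
      have e0 : (vecUx a : J1 m).toJ0 = 0 := rfl
      have e1 : vecU0 (vecUx a : J1 m).uy = (0 : J0 m) := rfl
      rw [fderiv_fderiv_bilLag_vecUx (hev hγ₀s z hz), e0, e1]
      simp
    have hyy : ∀ a b, fderiv ℝ (fderiv ℝ (bilLag γ₀)) z (vecUy a) (vecUy b) = 0 := by
      intro a b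
      have e0 : (vecUy a : J1 m).toJ0 = 0 := rfl
      have e1 : vecU0 (vecUy a : J1 m).ux = (0 : J0 m) := rfl
      rw [fderiv_fderiv_bilLag_vecUy (hev hγ₀s z hz), e0, e1]
      simp
    simp only [σ, omegaJ1, dCartan_eq (fderiv_fderiv_symm (hL₀ z hz).self_of_nhds) hxx hyy
      (jet0 f z), hlagR z hz, basicForm, ← tri_sub_tri _ _ (R z)]
    have hvx : ∀ v : J1 m, (coframe z (jet0 f z) v).x = v.x := fun _ => rfl
    have hvy : ∀ v : J1 m, (coframe z (jet0 f z) v).y = v.y := fun _ => rfl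
    simp only [hvx, hvy]
    ring
  have hσs : ∀ z ∈ U, ∀ a b c, ContDiffAt ℝ ∞ (fun y => σ y a b c) z := fun z hz a b c =>
    (hωs z hz a b c).sub (contDiffAt_dCartan (hL₀ z hz) a b c)
  have hσcl : ClosedOn σ U := by
    intro z hz a b c d
    have h : ∀ a b c e, fderiv ℝ (fun y => σ y a b c) z e
        = fderiv ℝ (fun y => omegaJ1 f T S R y a b c) z e
          - fderiv ℝ (fun y => dCartan (bilLag γ₀) y a b c) z e := by
      intro a b c e
      have := fderiv_fun_sub ((hωs z hz a b c).differentiableAt (by simp))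
        ((contDiffAt_dCartan (hL₀ z hz) a b c).differentiableAt (by simp))
      exact congrArg (fun φ => φ e) this
    rw [h, h, h, h]
    linear_combination hωcl z hz a b c d - dCartan_closed (hL₀ z hz) a b c d
  obtain ⟨β, hβs, hβa, hβd⟩ := exists_primitive_on_J0 hU hconv hσs hσcl
    (fun z hz a a' b c => by
      rw [hσ z hz, hσ z hz, hσ z hz, coframe_add, basicForm_add _ _ (el_add _ _ _)])
    (fun z hz r a b c => by
      rw [hσ z hz, hσ z hz, coframe_smul, basicForm_smul _ _ (el_smul _ _ _)])
    (fun z hz a b c => by rw [hσ z hz, hσ z hz, basicForm_swap_left])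
    (fun z hz a b c => by rw [hσ z hz, hσ z hz, basicForm_swap_right])
    (fun z hz e he b c => by
      rw [hσ z hz, basicForm_of_vertical _ _ (el_zero _ _ _) (coframe_toJ0_eq_zero _ _ he)])
  let γ : J0 m → J0 m →L[ℝ] J0 m →L[ℝ] ℝ := fun y => γ₀ y + β y
  have hγs : ContDiffOn ℝ ∞ γ (J1.toJ0 '' U) := hγ₀s.add hβs
  have hγv : ∀ a b, ContDiffOn ℝ ∞ (fun y => γ y a b) (J1.toJ0 '' U) := fun a b =>
    (hγs.clm_apply contDiffOn_const).clm_apply contDiffOn_const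
  -- On (∂_u, D_x, D_y) the form σ = dβ equals -E(L₀) at u_xy = f. The contribution of β thus
  -- removes E(L₀) at u_xy = f, leaving the part linear in u_xy - f.
  have hel : ∀ z ∈ U, ∀ w a, el (bilLag γ) z w a
      = -bil (R z) (w.uxy - f z) a - bil (R z) a (w.uxy - f z) := by
    intro z hz w a
    have hd : fderiv ℝ γ z.toJ0 = fderiv ℝ γ₀ z.toJ0 + fderiv ℝ β z.toJ0 :=
      fderiv_fun_add ((hev hγ₀s z hz).self_of_nhds.differentiableAt (by simp))
        ((hev hβs z hz).self_of_nhds.differentiableAt (by simp))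
    have h0 := el_bilLag (hev hγ₀s z hz) (jet0 f z) a
    have h1 := hβd z hz (vecU0 a) (tot0X z) (tot0Y z)
    have h2 : σ z (incJ0 (vecU0 a)) (incJ0 (tot0X z)) (incJ0 (tot0Y z))
        = -el (bilLag γ₀) z (jet0 f z) a := by
      rw [hσ z hz]
      simp [basicForm, tri, bil_zero_matrix, coframe, incJ0_apply, tot0X, tot0Y, vecU0_apply,
        J1.x, J1.y, J1.u, J1.ux, J1.uy, bil_zero_left, bil_zero_right, el_zero]
    have h3 : fderiv ℝ β z.toJ0 (tot0Y z) (vecU0 a) (tot0X z)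
        = -fderiv ℝ β z.toJ0 (tot0Y z) (tot0X z) (vecU0 a) := by
      have hb : HasFDerivAt β (fderiv ℝ β z.toJ0) z.toJ0 :=
        ((hev hβs z hz).self_of_nhds.differentiableAt (by simp)).hasFDerivAt
      have hb' : ∀ v w e, fderiv ℝ (fun y => β y v w) z.toJ0 e = fderiv ℝ β z.toJ0 e v w := by
        intro v w e
        rw [((hb.clm_apply (hasFDerivAt_const v _)).clm_apply (hasFDerivAt_const w _)).fderiv]
        simp
      have hloc : (fun y => β y (vecU0 a) (tot0X z)) =ᶠ[𝓝 z.toJ0]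
          fun y => -β y (tot0X z) (vecU0 a) := by
        filter_upwards [hV.mem_nhds (hVz z hz)] with y hy
        obtain ⟨z', hz', rfl⟩ := hy
        exact hβa z' hz' _ _
      rw [← hb', ← hb', hloc.fderiv_eq, fderiv_fun_neg, neg_apply]
    rw [h2, h3] at h1
    have hfz : (jet0 f z).uxy = f z := rfl
    rw [hfz] at h0
    rw [el_bilLag (hev hγs z hz), hd]
    simp only [γ, add_apply, hγ₀ z hz, sub_eq_add_neg, bil_add_left, bil_add_right] at h0 ⊢
    have hn1 : bil (R z) (-f z) a = -bil (R z) (f z) a := by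
      rw [← neg_one_smul ℝ (f z), bil_smul_left]; ring
    have hn2 : bil (R z) a (-f z) = -bil (R z) a (f z) := by
      rw [← neg_one_smul ℝ (f z), bil_smul_right]; ring
    rw [hn1, hn2]
    have hβa' := hβa z hz (vecU0 a) (vecU0 w.uxy)
    linear_combination h1 - h0 - hβa'
  -- The multiplier is -(R + Rᵀ), as `hel` dictates; the other witnesses are the components of γ, up
  -- to sign.
  refine ⟨fun y α β => -(R₀ α β y + R₀ β α y),
    fun y α β => -γ y (vecU0 (Pi.single α 1)) (vecU0 (Pi.single β 1)),
    fun y α => γ y (vecU0 (Pi.single α 1)) (0, 1, 0),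
    fun y α => γ y (1, 0, 0) (vecU0 (Pi.single α 1)),
    fun y => γ y (1, 0, 0) (0, 1, 0),
    fun α β => ((hR₀s α β).add (hR₀s β α)).neg, fun α β => (hγv _ _).neg, fun α => hγv _ _,
    fun α => hγv _ _, hγv _ _, ?_⟩
  have hM : ∀ z ∈ U, (fun α β => -(R₀ α β z.toJ0 + R₀ β α z.toJ0) :
      Matrix (Fin m) (Fin m) ℝ) = -(R z + (R z).transpose) := by
    intro z hz
    ext α β
    simp only [hR₀ _ _ z hz, Matrix.neg_apply, Matrix.add_apply, Matrix.transpose_apply]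
  rw [quadLagrangian_eq_bilLag]
  refine ⟨fun α β => ?_, ?_, ?_, ?_⟩
  · refine ContDiffOn.congr ((hR α β).add (hR β α)).neg fun z hz => ?_
    simp only [hR₀ _ _ z hz]
  · exact fun z hz => (contDiffAt_bilLag (hev hγs z hz).self_of_nhds).contDiffWithinAt
  · intro z hz
    refine (congrArg Matrix.det (hM z hz)).trans_ne ?_
    rw [Matrix.det_neg]
    exact mul_ne_zero (pow_ne_zero _ (by norm_num)) (hdet z hz)
  · intro z hz w α
    rw [eulerLagrange_eq_el (contDiffAt_bilLag (hev hγs z hz).self_of_nhds), hel z hz]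
    simp only [hR₀ _ _ z hz, bil, Pi.single_apply, Pi.sub_apply, mul_ite, mul_one, mul_zero, ite_mul,
      zero_mul, Finset.sum_ite_eq', Finset.mem_univ, if_true, Finset.sum_ite_irrel,
      Finset.sum_const_zero, ← Finset.sum_neg_distrib, ← Finset.sum_sub_distrib]
    refine Finset.sum_congr rfl fun β _ => ?_
    ring

theorem HasZerothOrderMultiplier.hasFirstOrderMultiplier {f : J1 m → Fin m → ℝ} {U : Set (J1 m)}
    (h : HasZerothOrderMultiplier f U) : HasFirstOrderMultiplier f U := by
  obtain ⟨M, R, Q, P, N, -, -, -, -, -, h⟩ := h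
  exact ⟨_, _, h⟩

theorem tfae_of_convex {f : J1 m → Fin m → ℝ} {U : Set (J1 m)} (hU : IsOpen U)
    (hconv : Convex ℝ U) (hf : ContDiffOn ℝ ∞ f U) :
    List.TFAE [HasClosedForm f U, HasFirstOrderMultiplier f U, HasZerothOrderMultiplier f U] := by
  tfae_have 1 → 3 := HasClosedForm.hasZerothOrderMultiplier hU hconv hf
  tfae_have 3 → 2 := HasZerothOrderMultiplier.hasFirstOrderMultiplier
  tfae_have 2 → 1 := HasFirstOrderMultiplier.hasClosedForm hU
  tfae_finish

/-! ### Restriction to smaller sets -/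

theorem HasClosedForm.mono {f : J1 m → Fin m → ℝ} {U W : Set (J1 m)} (hWU : W ⊆ U)
    (h : HasClosedForm f U) : HasClosedForm f W := by
  obtain ⟨T, S, R, hT, hS, hR, hdet, hcl⟩ := h
  have hsub : RInf.toJ1 ⁻¹' W ⊆ RInf.toJ1 ⁻¹' U := Set.preimage_mono hWU
  exact ⟨T, S, R, fun α β p hp => hT α β p (hsub hp), fun α β p hp => hS α β p (hsub hp),
    fun α β p hp => hR α β p (hsub hp), fun p hp => hdet p (hsub hp),
    fun p hp => hcl p (hsub hp)⟩

end

end FGordon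

/-! ### The equivalences, on convex sets and locally. -/

theorem theorem6p1 (m : ℕ) (U : Set (FGordon.J1 m)) (hU : IsOpen U)
    (f : FGordon.J1 m → Fin m → ℝ) (hf : ContDiffOn ℝ ∞ f U) :
    (Convex ℝ U → List.TFAE
      [FGordon.HasClosedForm f U,
       FGordon.HasFirstOrderMultiplier f U,
       FGordon.HasZerothOrderMultiplier f U]) ∧
    (∀ z ∈ U, List.TFAE
      [∃ W ⊆ U, IsOpen W ∧ z ∈ W ∧ FGordon.HasClosedForm f W,
       ∃ W ⊆ U, IsOpen W ∧ z ∈ W ∧ FGordon.HasFirstOrderMultiplier f W,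
       ∃ W ⊆ U, IsOpen W ∧ z ∈ W ∧ FGordon.HasZerothOrderMultiplier f W]) := by
  refine ⟨fun hconv => FGordon.tfae_of_convex hU hconv hf, fun z hz => ?_⟩
  tfae_have 1 → 3 := by
    rintro ⟨W, hWU, hW, hzW, h⟩
    -- Only this implication needs convexity, and closed forms restrict to a ball around z.
    obtain ⟨ε, hε, hball⟩ := Metric.isOpen_iff.1 hW z hzW
    exact ⟨Metric.ball z ε, hball.trans hWU, Metric.isOpen_ball, Metric.mem_ball_self hε,
      (h.mono hball).hasZerothOrderMultiplier Metric.isOpen_ball (convex_ball z ε)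
        (hf.mono (hball.trans hWU))⟩
  tfae_have 3 → 2 := by
    rintro ⟨W, hWU, hW, hzW, h⟩
    exact ⟨W, hWU, hW, hzW, h.hasFirstOrderMultiplier⟩
  tfae_have 2 → 1 := by
    rintro ⟨W, hWU, hW, hzW, h⟩
    exact ⟨W, hWU, hW, hzW, h.hasClosedForm hW⟩
  tfae_finish
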